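/- Let $M$ be a matroid on a finite set $E$ equipped with a linear order $<$. For $S\subseteq E$ let $\operatorname{EA}(S)$ be the set of $e\in E\setminus S$ that are the maximum of some circuit of $M$ contained in $S\cup\{e\}$, let $\operatorname{EP}(S)=(E\setminus S)\setminus\operatorname{EA}(S)$, and let $\operatorname{IA}(S)$ be the set of $i\in S$ that are the maximum of some circuit of the dual matroid contained in $(E\setminus S)\cup\{i\}$. Call independent sets $I,J$ internally related if there are a basis $B$ and $Y,Y'\subseteq\operatorname{IA}(B)$ with $I=B\setminus Y$ and $J=B\setminus Y'$. For independent sets put $I\le_{ext/int}J$ if either $I,J$ are internally related and $I\subseteq J$, or they are not internally related and $(I\setminus\operatorname{IA}(I))\cup\operatorname{EA}(I)\subseteq(J\setminus\operatorname{IA}(J))\cup\operatorname{EA}(J)$. Theorem. (1) Every independent set $I$ of $M$ is $I=B\setminus Y$ for a unique pair $(B,Y)$ with $B$ a basis and $Y\subseteq\operatorname{IA}(B)$. Put $$F(I)=\{x_e: e\in I\cup\operatorname{EP}(I)\}\cup\{y_e: e\in Y\}\cup\{z_e: e\in I\cup\operatorname{EA}(I)\}\subseteq\{x_e,y_e,z_e: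 e\in E\},$$ and let the augmented external activity complex $\Delta_M$ be the simplicial complex generated by the sets $F(I)$, $I$ independent. (2) $I\mapsto F(I)$ is a bijection from the independent sets of $M$ to the facets of $\Delta_M$, and $\le_{ext/int}$ is a partial order on the independent sets of $M$. (3) If $I_1,\dots,I_s$ is an enumeration without repetition of the independent sets of $M$ that is a linear extension of $\le_{ext/int}$ (that is, $I_k\le_{ext/int}I_l$ implies $k\le l$), then $F(I_1),\dots,F(I_s)$ is a shelling order of $\Delta_M$: the complex is pure, these are its facets, each listed once, and for all $i<k$ there are $j<k$ and $v\in F(I_k)$ with $F(I_i)\cap F(I_k)\subseteq F(I_j)\cap F(I_k)=F(I_k)\setminus\{v\}$. (4) In particular, $\Delta_M$ is shellable (it has a shelling order), and it is Cohen–Macaulay over every commutative ring $R$ (in particular over every field and over $\mathbb Z$): for every face $\sigma$ of $\Delta_M$, including $\sigma=\emptyset$, one has $\widetilde H_i(\operatorname{lk}\sigma;R)=0$ for all $i<\dim\operatorname{lk}\sigma$. -/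

import Mathlib

/-! ### Simplicial complexes, shellings, Cohen–Macaulayness -/

/-- An abstract simplicial complex, given by its faces; the empty set is allowed as a face
(so that the complex `{∅}` has the facet `∅`, and links and reduced homology are available). -/
structure FaceComplex (V : Type*) where
  faces : Set (Finset V)
  down_closed : ∀ s ∈ faces, ∀ t, t ⊆ s → t ∈ faces

namespace FaceComplex

variable {V : Type*}

/-- The facets: the inclusion-maximal faces. -/
def facets (D : FaceComplex V) : Set (Finset V) := {F | Maximal (· ∈ D.faces) F}

/-- All facets have the same cardinality. -/
def IsPure (D : FaceComplex V) : Prop :=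
  ∀ F ∈ D.facets, ∀ G ∈ D.facets, F.card = G.card

/-- `F 0, F 1, …, F (s-1)` is a shelling order of `D`: `D` is pure, the `F k` list the facets of
`D` without repetition, and for `i < k` there are `j < k` and `e ∈ F k` with
`F i ∩ F k ⊆ F j ∩ F k = F k \ e`. -/
def IsShellingOrder [DecidableEq V] (D : FaceComplex V) {s : ℕ} (F : Fin s → Finset V) : Prop :=
  D.IsPure ∧ Function.Injective F ∧ Set.range F = D.facets ∧
    ∀ i k, i < k → ∃ j, j < k ∧ ∃ e ∈ F k,
      F i ∩ F k ⊆ F j ∩ F k ∧ F j ∩ F k = (F k).erase e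

/-- A complex with a shelling order. -/
def IsShellable [DecidableEq V] (D : FaceComplex V) : Prop :=
  ∃ (s : ℕ) (F : Fin s → Finset V), D.IsShellingOrder F

/-- The link of `σ`. -/
def link [DecidableEq V] (D : FaceComplex V) (σ : Finset V) : FaceComplex V where
  faces := {τ | Disjoint τ σ ∧ τ ∪ σ ∈ D.faces}
  down_closed := fun _ hs _ ht =>
    ⟨Finset.disjoint_of_subset_left ht hs.1,
      D.down_closed _ hs.2 _ (Finset.union_subset_union_left ht)⟩

/-- The simplicial chains with coefficients in `R` supported on the faces with `m` vertices,
that is, on the faces of dimension `m - 1`; for `m = 0` this is the augmentation term. -/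
def chains (D : FaceComplex V) (R : Type*) [CommRing R] (m : ℕ) : Submodule R (Finset V →₀ R) :=
  Finsupp.supported R R {σ | σ ∈ D.faces ∧ σ.card = m}

/-- The boundary map of the augmented simplicial chain complex, every face being oriented by the
linear order of its vertices: `∂ σ = ∑_{v ∈ σ} (-1)^{#{w ∈ σ : w < v}} (σ \ v)`. -/
noncomputable def boundary (V : Type*) [LinearOrder V] (R : Type*) [CommRing R] :
    (Finset V →₀ R) →ₗ[R] (Finset V →₀ R) :=
  Finsupp.linearCombination R fun σ : Finset V =>
    ∑ v ∈ σ, Finsupp.single (σ.erase v) ((-1 : R) ^ (σ.filter (· < v)).card)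

/-- The reduced simplicial homology of `D` over `R` vanishes in degree `m - 1`: every cycle is a
boundary. -/
def ReducedHomologyVanishes [LinearOrder V] (D : FaceComplex V) (R : Type*) [CommRing R]
    (m : ℕ) : Prop :=
  ∀ c ∈ D.chains R m, boundary V R c = 0 → ∃ b ∈ D.chains R (m + 1), boundary V R b = c

/-- `D` is Cohen–Macaulay over `R`: for every face `σ`, the reduced homology over `R` of the link
of `σ` vanishes in all degrees smaller than the dimension of the link. (Degree `m - 1` is smaller
than that dimension exactly when the link has a face with more than `m` vertices.) -/
def IsCohenMacaulay [LinearOrder V] (D : FaceComplex V) (R : Type*) [CommRing R] : Prop :=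
  ∀ σ ∈ D.faces, ∀ m : ℕ, (∃ τ ∈ (D.link σ).faces, m < τ.card) →
    (D.link σ).ReducedHomologyVanishes R m

end FaceComplex

/-! ### Matroid activities -/

namespace Matroid

variable {α : Type*} [LinearOrder α]

/-- `EA(S)`: the `e ∈ E \ S` that are the maximum of a circuit contained in `S ∪ e`. -/
def extActive (M : Matroid α) (S : Set α) : Set α :=
  {e | e ∈ M.E \ S ∧ ∃ C, M.IsCircuit C ∧ C ⊆ insert e S ∧ IsGreatest C e}

/-- `EP(S)`: the elements of `E \ S` that are not externally active. -/
def extPassive (M : Matroid α) (S : Set α) : Set α :=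
  (M.E \ S) \ M.extActive S

/-- `IA(S)`: the `i ∈ S` that are externally active for `E \ S` in the dual matroid. -/
def intActive (M : Matroid α) (S : Set α) : Set α :=
  {i | i ∈ S ∧ i ∈ M✶.extActive (M.E \ S)}

/-- `I = B \ Y` with `B` a basis and `Y ⊆ IA(B)`. -/
def IsIntDecomp (M : Matroid α) (I B Y : Set α) : Prop :=
  M.IsBase B ∧ Y ⊆ M.intActive B ∧ I = B \ Y

/-- `I` and `J` are internally related: both arise from one basis `B` by deleting internally
active elements of `B`. -/
def IntRelated (M : Matroid α) (I J : Set α) : Prop :=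
  ∃ B Y Y', M.IsIntDecomp I B Y ∧ M.IsIntDecomp J B Y'

/-- The external/internal order on independent sets. -/
def ExtIntLE (M : Matroid α) (I J : Set α) : Prop :=
  (¬ M.IntRelated I J ∧
    (I \ M.intActive I) ∪ M.extActive I ⊆ (J \ M.intActive J) ∪ M.extActive J) ∨
  (M.IntRelated I J ∧ I ⊆ J)

/-- `I 0, I 1, …, I (s-1)` lists the independent sets of `M` without repetition in an order
which is a linear extension of the external/internal order. -/
def IsExtIntLinearExtension (M : Matroid α) {s : ℕ} (I : Fin s → Set α) : Prop :=
  Function.Injective I ∧ Set.range I = {S | M.Indep S} ∧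
    ∀ k l, M.ExtIntLE (I k) (I l) → k ≤ l

/-- The set `Y` of the decomposition `I = B \ Y` with `B` a basis and `Y ⊆ IA(B)`, which is unique
for independent `I` (formally, the union of all such `Y`). -/
def intDeleted (M : Matroid α) (I : Set α) : Set α :=
  {e | ∃ B Y, M.IsIntDecomp I B Y ∧ e ∈ Y}

end Matroid

/-! ### The augmented external activity complex -/

/-- The vertex set `{x_e, y_e, z_e}`. -/
inductive AugVertex (α : Type*) where
  | x (e : α)
  | y (e : α)
  | z (e : α)

namespace AugVertex

variable {α : Type*}

/-- `x_e`, `y_e`, `z_e` as the pairs `(0, e)`, `(1, e)`, `(2, e)`. -/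
def toPair : AugVertex α → Fin 3 ×ₗ α
  | x e => toLex (0, e)
  | y e => toLex (1, e)
  | z e => toLex (2, e)

theorem toPair_injective : Function.Injective (toPair : AugVertex α → Fin 3 ×ₗ α) := by
  intro a b h
  cases a <;> cases b <;> simp_all [toPair]

/-- All `x_e` come first, then all `y_e`, then all `z_e`. (The order serves only to orient the
simplices in the definition of homology.) -/
noncomputable instance [LinearOrder α] : LinearOrder (AugVertex α) :=
  LinearOrder.lift' toPair toPair_injective

end AugVertex

namespace Matroid

variable {α : Type*} [LinearOrder α]

open Classical in
/-- A subset `S` of the ground set of a finite matroid, as a `Finset`. -/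
noncomputable def groundFinset (M : Matroid α) [M.Finite] (S : Set α) : Finset α :=
  M.ground_finite.toFinset.filter (· ∈ S)

/-- `F(I) = x_{I ∪ EP(I)} y_Y z_{I ∪ EA(I)}`, where `I = B \ Y`, `B` a basis, `Y ⊆ IA(B)`. -/
noncomputable def augFacet (M : Matroid α) [M.Finite] (I : Set α) : Finset (AugVertex α) :=
  (M.groundFinset (I ∪ M.extPassive I)).image AugVertex.x ∪
    (M.groundFinset (M.intDeleted I)).image AugVertex.y ∪
    (M.groundFinset (I ∪ M.extActive I)).image AugVertex.z

/-- The augmented external activity complex of `M`, generated by the sets `F(I)`, `I` independent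
in `M`. -/
noncomputable def augExtActivityComplex (M : Matroid α) [M.Finite] :
    FaceComplex (AugVertex α) where
  faces := {G | ∃ I, M.Indep I ∧ G ⊆ M.augFacet I}
  down_closed := fun _ ⟨I, hI, hs⟩ _ ht => ⟨I, hI, ht.trans hs⟩

end Matroid

/-!
Every basis `B` is described by its exchange relation: `b ∈ B` and `e ∉ B` are exchangeable if
`e ∉ cl(B \ b)`. An element `e ∉ B` is externally active iff it exceeds all `b` exchangeable with
it, and `b ∈ B` is internally active iff it exceeds all `e` exchangeable with it.

*Decomposition and order.* The basis belonging to an independent set `I` is the colexicographically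
largest one containing `I`; the deleted set consists of the `e ∉ I` with `e ∉ cl(I ∪ {> e})`, which
gives uniqueness. The fundamental circuit of `e` contains no internally active element below `e`
(`IsBase.mem_closure_sdiff_intActive`). Hence neither the external activity nor the set of
internally passive elements changes when internally active elements are deleted, and
`≤_{ext/int}` compares first the sets `IP(B) ∪ EA(B)` of the two bases, where
`IP(B) = B \ IA(B)`, and then, within one basis, the independent sets by inclusion. It is a partial
order because `IP(B) ∪ EA(B)` determines `B`.

*Shelling.* All `F(I)` have `|E| + r(M)` elements, and `F(I)` consists of the `x_e` with
`e ∉ EA(B)`, the `y_e` with `e ∈ Y` and the `z_e` with `e ∈ I ∪ EA(B)`. The restriction set of `F(I)`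
is `{z_b : b ∈ I}`. Indeed, for each `b ∈ I` there is a `J < I` whose facet contains `F(I) \ z_b`
(`IsIntDecomp.exists_neighbour`): if `b` is internally active, `J = I \ b`; otherwise `b` is
replaced by the least externally active element exchangeable with it, or, if there is none, by the
largest element exchangeable with it, which is then deleted again. Conversely, if `F(I')` contains
all these `z_b`, that is, if `I ⊆ I' ∪ EA(I')`, then `I ≤ I'`
(`IsIntDecomp.extIntLE_of_subset_union`).

*Cohen–Macaulayness.* Adding the `k`-th facet `F` of a shelling, with restriction set `R`, adds to
the link of `σ` the faces `τ` with `R ⊆ τ ∪ σ ⊆ F`. Coning with a vertex of `F` outside `R ∪ σ`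
contracts the chains on the new faces, so that every cycle is homologous to one on the old faces
(`exists_boundary_of_cone`); if there is no such vertex, the only new face has top dimension.
-/

/-! ### The cone operator on chains -/

namespace FaceComplex

variable {V : Type*} [LinearOrder V] {R : Type*} [CommRing R]

/-- The sign with which `σ \ v` occurs in the boundary of `σ`. -/
def vertexSign (R : Type*) [CommRing R] (v : V) (σ : Finset V) : R :=
  (-1) ^ (σ.filter (· < v)).card

lemma vertexSign_mul_self (v : V) (σ : Finset V) :
    vertexSign R v σ * vertexSign R v σ = 1 := by
  rw [vertexSign, ← mul_pow]; simp

lemma vertexSign_erase_self (v : V) (σ : Finset V) :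
    vertexSign R v (σ.erase v) = vertexSign R v σ := by
  rw [vertexSign, vertexSign, Finset.filter_erase, Finset.erase_eq_of_notMem (by simp)]

lemma vertexSign_insert_self (v : V) (σ : Finset V) :
    vertexSign R v (insert v σ) = vertexSign R v σ := by
  rw [vertexSign, vertexSign, Finset.filter_insert, if_neg (lt_irrefl v)]

/-- Exchanging the order in which two vertices are added or removed changes the sign. -/
lemma vertexSign_exchange {v w : V} {σ : Finset V} (hv : v ∉ σ) (hw : w ∈ σ) :
    vertexSign R v σ * vertexSign R w (insert v σ) =
      -(vertexSign R w σ * vertexSign R v (σ.erase w)) := by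
  have hvw : v ≠ w := fun h => hv (h ▸ hw)
  simp only [vertexSign]
  rw [Finset.filter_insert, Finset.filter_erase]
  rcases lt_or_gt_of_ne hvw with h | h
  · rw [if_pos h, Finset.card_insert_of_notMem (by simp [hv]), Finset.erase_eq_of_notMem
      (by simp [h.le]), pow_succ]
    ring
  · have hmem : w ∈ σ.filter (· < v) := by simp [hw, h]
    rw [if_neg h.le.not_gt, ← Finset.card_erase_add_one hmem, pow_succ]
    ring

lemma boundary_single (σ : Finset V) :
    boundary V R (Finsupp.single σ 1) =
      ∑ v ∈ σ, vertexSign R v σ • Finsupp.single (σ.erase v) 1 := by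
  simp [boundary, vertexSign]

/-- The cone operator with apex `v`: it adds the vertex `v`, with a sign, to the faces that do not
contain it, and kills those that do. -/
noncomputable def cone (R : Type*) [CommRing R] (v : V) : (Finset V →₀ R) →ₗ[R] (Finset V →₀ R) :=
  Finsupp.linearCombination R fun σ : Finset V =>
    if v ∈ σ then 0 else vertexSign R v σ • Finsupp.single (insert v σ) 1

lemma cone_single_of_mem {v : V} {σ : Finset V} (hv : v ∈ σ) :
    cone R v (Finsupp.single σ 1) = 0 := by
  simp [cone, hv]

lemma cone_single_of_notMem {v : V} {σ : Finset V} (hv : v ∉ σ) :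
    cone R v (Finsupp.single σ 1) = vertexSign R v σ • Finsupp.single (insert v σ) 1 := by
  simp [cone, hv]

/-- The cone operator contracts the augmented chain complex of the full simplex. -/
lemma boundary_cone_add_cone_boundary (v : V) (c : Finset V →₀ R) :
    boundary V R (cone R v c) + cone R v (boundary V R c) = c := by
  suffices h : boundary V R ∘ₗ cone R v + cone R v ∘ₗ boundary V R = LinearMap.id from
    LinearMap.congr_fun h c
  refine Finsupp.lhom_ext' fun σ => LinearMap.ext_ring ?_
  simp only [LinearMap.comp_apply, LinearMap.add_apply, Finsupp.lsingle_apply, LinearMap.id_apply]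
  by_cases hv : v ∈ σ
  · rw [cone_single_of_mem hv, map_zero, zero_add, boundary_single, map_sum,
      Finset.sum_eq_single_of_mem v hv]
    · rw [map_smul, cone_single_of_notMem (Finset.notMem_erase v σ), smul_smul,
        vertexSign_erase_self, vertexSign_mul_self, one_smul, Finset.insert_erase hv]
    · intro w _ hwv
      rw [map_smul, cone_single_of_mem (Finset.mem_erase.2 ⟨hwv.symm, hv⟩), smul_zero]
  · rw [cone_single_of_notMem hv, map_smul, boundary_single, boundary_single,
      Finset.sum_insert hv, smul_add, smul_smul, vertexSign_insert_self, vertexSign_mul_self,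
      one_smul, Finset.erase_insert hv, add_assoc, add_eq_left, Finset.smul_sum, map_sum,
      ← Finset.sum_add_distrib]
    refine Finset.sum_eq_zero fun w hw => ?_
    have hvw : v ≠ w := fun h => hv (h ▸ hw)
    rw [map_smul, cone_single_of_notMem (fun h => hv (Finset.mem_of_mem_erase h)), smul_smul,
      smul_smul, vertexSign_exchange hv hw, Finset.erase_insert_of_ne hvw, neg_smul,
      neg_add_cancel]

/-- The boundary of a boundary vanishes. By induction on the number of vertices: a nonempty face
is, up to sign, a cone, and the contraction formula turns `∂ ∂ h` into `h ∂ ∂`. -/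
lemma boundary_boundary (c : Finset V →₀ R) : boundary V R (boundary V R c) = 0 := by
  suffices h : boundary V R ∘ₗ boundary V R = 0 from LinearMap.congr_fun h c
  refine Finsupp.lhom_ext' fun σ => LinearMap.ext_ring ?_
  simp only [LinearMap.comp_apply, Finsupp.lsingle_apply, LinearMap.zero_apply]
  induction σ using Finset.induction_on with
  | empty => simp [boundary_single]
  | insert v τ hv ih =>
    have h1 : Finsupp.single (insert v τ) (1 : R) =
        vertexSign R v τ • cone R v (Finsupp.single τ 1) := by
      rw [cone_single_of_notMem hv, smul_smul, vertexSign_mul_self, one_smul]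
    have h2 := boundary_cone_add_cone_boundary v (Finsupp.single τ (1 : R))
    have h3 := boundary_cone_add_cone_boundary v (boundary V R (Finsupp.single τ (1 : R)))
    rw [ih, map_zero, add_zero] at h3
    rw [h1, map_smul, map_smul, eq_sub_of_add_eq h2, map_sub, h3, sub_self, smul_zero]

/-- A linear map on chains takes chains supported on `s` to chains supported on `t` as soon as it
does so for the faces in `s`. -/
lemma map_mem_supported {V : Type*} {s t : Set (Finset V)}
    (f : (Finset V →₀ R) →ₗ[R] (Finset V →₀ R))
    (h : ∀ σ ∈ s, f (Finsupp.single σ 1) ∈ Finsupp.supported R R t)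
    {c : Finset V →₀ R} (hc : c ∈ Finsupp.supported R R s) :
    f c ∈ Finsupp.supported R R t := by
  rw [Finsupp.supported_eq_span_single] at hc
  induction hc using Submodule.span_induction with
  | mem x hx => obtain ⟨σ, hσ, rfl⟩ := hx; exact h σ hσ
  | zero => simp
  | add x y _ _ hx hy => rw [map_add]; exact add_mem hx hy
  | smul a x _ hx => rw [map_smul]; exact Submodule.smul_mem _ a hx

lemma boundary_mem_supported {s t : Set (Finset V)} (h : ∀ σ ∈ s, ∀ v ∈ σ, σ.erase v ∈ t)
    {c : Finset V →₀ R} (hc : c ∈ Finsupp.supported R R s) :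
    boundary V R c ∈ Finsupp.supported R R t := by
  refine map_mem_supported _ (fun σ hσ => ?_) hc
  rw [boundary_single]
  exact sum_mem fun v hv => Submodule.smul_mem _ _ (Finsupp.single_mem_supported R 1 (h σ hσ v hv))

lemma cone_mem_supported {s t : Set (Finset V)} {v : V}
    (h : ∀ σ ∈ s, v ∉ σ → insert v σ ∈ t)
    {c : Finset V →₀ R} (hc : c ∈ Finsupp.supported R R s) :
    cone R v c ∈ Finsupp.supported R R t := by
  refine map_mem_supported _ (fun σ hσ => ?_) hc
  by_cases hv : v ∈ σ
  · rw [cone_single_of_mem hv]; exact zero_mem _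
  · rw [cone_single_of_notMem hv]
    exact Submodule.smul_mem _ _ (Finsupp.single_mem_supported R 1 (h σ hσ hv))

/-! ### Shellable complexes are Cohen–Macaulay -/

/-- Adding a facet without creating homology. The complex with face set `X ∪ N` arises from the
one with face set `X` by adding the faces in `N`; the apex `v` can be added to the faces in `N`
without leaving `N`, and to those boundary faces of `N` which lie in `X` without leaving `X`.
Then a cycle of `X ∪ N` is homologous to one of `X`. -/
lemma exists_boundary_of_cone {X N : Set (Finset V)} {v : V} {m : ℕ}
    (hX : ∀ σ ∈ X, ∀ w ∈ σ, σ.erase w ∈ X)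
    (hN : ∀ σ ∈ N, v ∉ σ → insert v σ ∈ N)
    (hNX : ∀ σ ∈ N, ∀ w ∈ σ, σ.erase w ∈ X → v ∉ σ.erase w → insert v (σ.erase w) ∈ X)
    (hvan : ∀ c ∈ Finsupp.supported R R {σ | σ ∈ X ∧ σ.card = m}, boundary V R c = 0 →
      ∃ b ∈ Finsupp.supported R R {σ | σ ∈ X ∧ σ.card = m + 1}, boundary V R b = c)
    {c : Finset V →₀ R} (hc : c ∈ Finsupp.supported R R {σ | σ ∈ X ∪ N ∧ σ.card = m})
    (hc0 : boundary V R c = 0) :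
    ∃ b ∈ Finsupp.supported R R {σ | σ ∈ X ∪ N ∧ σ.card = m + 1}, boundary V R b = c := by
  classical
  -- split `c` into its part on `X` and its part on the new faces
  set c₁ := c.filter (· ∈ X) with hc₁
  set c₂ := c.filter (· ∉ X) with hc₂
  have hsplit : c₁ + c₂ = c := Finsupp.filter_add_filter_not c _
  have hc₁m : c₁ ∈ Finsupp.supported R R {σ | σ ∈ X ∧ σ.card = m} := by
    intro σ hσ
    rw [hc₁, Finsupp.support_filter, Finset.mem_coe, Finset.mem_filter] at hσ
    exact ⟨hσ.2, (hc hσ.1).2⟩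
  have hc₂m : c₂ ∈ Finsupp.supported R R {σ | σ ∈ N ∧ σ.card = m} := by
    intro σ hσ
    rw [hc₂, Finsupp.support_filter, Finset.mem_coe, Finset.mem_filter] at hσ
    exact ⟨(hc hσ.1).1.resolve_left hσ.2, (hc hσ.1).2⟩
  have hb : cone R v c₂ ∈ Finsupp.supported R R {σ | σ ∈ N ∧ σ.card = m + 1} := by
    refine cone_mem_supported (fun σ hσ hv => ?_) hc₂m
    exact ⟨hN σ hσ.1 hv, by rw [Finset.card_insert_of_notMem hv, hσ.2]⟩
  -- `∂ c₂ = - ∂ c₁` is supported on the old faces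
  have hd₁ : boundary V R c₂ ∈ Finsupp.supported R R {τ | τ ∈ X ∧ τ.card + 1 = m} := by
    have h : boundary V R c₂ = -boundary V R c₁ := by
      rw [eq_neg_iff_add_eq_zero, ← map_add, add_comm, hsplit, hc0]
    rw [h]
    refine neg_mem (boundary_mem_supported (fun σ hσ w hw => ?_) hc₁m)
    exact ⟨hX σ hσ.1 w hw, by rw [Finset.card_erase_add_one hw, hσ.2]⟩
  have hd₂ : boundary V R c₂ ∈ Finsupp.supported R R {τ | ∃ σ ∈ N, ∃ w ∈ σ, τ = σ.erase w} := by
    refine boundary_mem_supported (fun σ hσ w hw => ?_) hc₂m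
    exact ⟨σ, hσ.1, w, hw, rfl⟩
  have hd : boundary V R c₂ ∈ Finsupp.supported R R
      ({τ | τ ∈ X ∧ τ.card + 1 = m} ∩ {τ | ∃ σ ∈ N, ∃ w ∈ σ, τ = σ.erase w}) := by
    rw [Finsupp.supported_inter]; exact ⟨hd₁, hd₂⟩
  have hcd : cone R v (boundary V R c₂) ∈ Finsupp.supported R R {σ | σ ∈ X ∧ σ.card = m} := by
    refine cone_mem_supported (fun τ hτ hv => ?_) hd
    obtain ⟨⟨hτX, hτm⟩, σ, hσ, w, hw, rfl⟩ := hτ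
    exact ⟨hNX σ hσ w hw hτX hv, by rw [Finset.card_insert_of_notMem hv, hτm]⟩
  have hhom : c - boundary V R (cone R v c₂) = c₁ + cone R v (boundary V R c₂) := by
    have h := boundary_cone_add_cone_boundary v c₂
    rw [← hsplit, eq_sub_of_add_eq h]
    abel
  obtain ⟨b, hbm, hb0⟩ := hvan (c - boundary V R (cone R v c₂))
    (by rw [hhom]; exact add_mem hc₁m hcd) (by rw [map_sub, boundary_boundary, hc0, sub_zero])
  refine ⟨b + cone R v c₂, add_mem ?_ ?_, by rw [map_add, hb0]; abel⟩
  · exact fun σ hσ => ⟨Or.inl (hbm hσ).1, (hbm hσ).2⟩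
  · exact fun σ hσ => ⟨Or.inr (hb hσ).1, (hb hσ).2⟩

/-- The vanishing of the homology of links, by induction along a shelling. The faces of the link
of `σ` in the subcomplex generated by the first `k` facets are the `τ` disjoint from `σ` with
`τ ∪ σ ⊆ F i` for some `i < k`. The faces `τ` that the `k`-th facet adds are those with
`res ⊆ τ ∪ σ ⊆ F k`, where `res` is the restriction set of `F k`; any vertex of `F k` outside
`res ∪ σ` serves as the apex of a cone, and if there is none, then the only new face has the
maximal cardinality. -/
lemma exists_boundary_of_shelling {s d : ℕ} {F : Fin s → Finset V} (hcard : ∀ k, (F k).card = d)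
    (hF : ∀ i k, i < k → ∃ j, j < k ∧ ∃ e ∈ F k,
      F i ∩ F k ⊆ F j ∩ F k ∧ F j ∩ F k = (F k).erase e)
    (σ : Finset V) {m : ℕ} (hm : m + σ.card < d) (k : ℕ) (hk : k ≤ s) :
    ∀ c ∈ Finsupp.supported R R
        {τ | τ ∈ {τ | Disjoint τ σ ∧ ∃ i : Fin s, i.1 < k ∧ τ ∪ σ ⊆ F i} ∧ τ.card = m},
      boundary V R c = 0 →
      ∃ b ∈ Finsupp.supported R R
        {τ | τ ∈ {τ | Disjoint τ σ ∧ ∃ i : Fin s, i.1 < k ∧ τ ∪ σ ⊆ F i} ∧ τ.card = m + 1},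
      boundary V R b = c := by
  classical
  induction k with
  | zero =>
    intro c hc _
    have hc' : c = 0 := by
      refine Finsupp.support_eq_empty.1 (Finset.eq_empty_of_forall_notMem fun τ hτ => ?_)
      obtain ⟨⟨-, i, hi, -⟩, -⟩ := hc hτ
      exact Nat.not_lt_zero _ hi
    exact ⟨0, zero_mem _, by rw [hc', map_zero]⟩
  | succ k ih =>
    have ih := ih (Nat.le_of_succ_le hk)
    set K : Fin s := ⟨k, hk⟩ with hK
    set X : Set (Finset V) := {τ | Disjoint τ σ ∧ ∃ i : Fin s, i.1 < k ∧ τ ∪ σ ⊆ F i} with hX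
    set res : Set V := {e | e ∈ F K ∧ ∃ j < K, F j ∩ F K = (F K).erase e} with hres
    set N : Set (Finset V) := {τ | Disjoint τ σ ∧ τ ∪ σ ⊆ F K ∧ res ⊆ ↑(τ ∪ σ)} with hN
    have hXsub : ∀ τ ∈ X, ∀ ρ ⊆ τ, ρ ∈ X := fun τ hτ ρ hρ =>
      ⟨Finset.disjoint_of_subset_left hρ hτ.1, hτ.2.imp fun i hi =>
        ⟨hi.1, (Finset.union_subset_union_left hρ).trans hi.2⟩⟩
    -- a face of `F K` is old iff it does not contain the restriction set
    have hold : ∀ τ, Disjoint τ σ → τ ∪ σ ⊆ F K → (τ ∈ X ↔ ¬ res ⊆ ↑(τ ∪ σ)) := by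
      intro τ hd hτ
      constructor
      · rintro ⟨-, i, hi, hτi⟩ hsub
        obtain ⟨j, hj, e, he, h1, h2⟩ := hF i K hi
        have he' : e ∈ τ ∪ σ := hsub ⟨he, j, hj, h2⟩
        have := h1 (Finset.mem_inter.2 ⟨hτi he', he⟩)
        rw [h2] at this
        exact Finset.notMem_erase _ _ this
      · intro h
        obtain ⟨e, ⟨he, j, hj, hje⟩, heτ⟩ := Set.not_subset.1 h
        refine ⟨hd, j, hj, fun x hx => ?_⟩
        have : x ∈ (F K).erase e := Finset.mem_erase.2 ⟨fun h => heτ (h ▸ hx), hτ hx⟩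
        rw [← hje] at this
        exact Finset.mem_of_mem_inter_left this
    have hXN : {τ | Disjoint τ σ ∧ ∃ i : Fin s, i.1 < k + 1 ∧ τ ∪ σ ⊆ F i} = X ∪ N := by
      ext τ
      constructor
      · rintro ⟨hd, i, hi, hτ⟩
        rcases Nat.lt_succ_iff_lt_or_eq.1 hi with hi | hi
        · exact Or.inl ⟨hd, i, hi, hτ⟩
        · obtain rfl : i = K := Fin.ext hi
          by_cases h : res ⊆ ↑(τ ∪ σ)
          · exact Or.inr ⟨hd, hτ, h⟩
          · exact Or.inl ((hold τ hd hτ).2 h)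
      · rintro (⟨hd, i, hi, hτ⟩ | ⟨hd, hτ, -⟩)
        · exact ⟨hd, i, hi.trans (Nat.lt_succ_self k), hτ⟩
        · exact ⟨hd, K, Nat.lt_succ_self k, hτ⟩
    rw [hXN]
    intro c hc hc0
    by_cases hv : ∃ v ∈ F K, v ∉ res ∧ v ∉ σ
    · obtain ⟨v, hvF, hvres, hvσ⟩ := hv
      have hins : ∀ τ, Disjoint τ σ → τ ∪ σ ⊆ F K →
          Disjoint (insert v τ) σ ∧ insert v τ ∪ σ ⊆ F K := fun τ hd hτ =>
        ⟨Finset.disjoint_insert_left.2 ⟨hvσ, hd⟩, by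
          rw [Finset.insert_union]; exact Finset.insert_subset hvF hτ⟩
      refine exists_boundary_of_cone (v := v)
        (fun τ hτ w _ => hXsub τ hτ _ (Finset.erase_subset w τ))
        (fun τ hτ _ => ?_) (fun τ hτ w _ hX' _ => ?_) ih hc hc0
      · refine ⟨(hins τ hτ.1 hτ.2.1).1, (hins τ hτ.1 hτ.2.1).2, hτ.2.2.trans ?_⟩
        exact Finset.coe_subset.2 (Finset.union_subset_union_left (Finset.subset_insert _ _))
      · have hd : Disjoint (τ.erase w) σ := hX'.1
        have hsub : τ.erase w ∪ σ ⊆ F K :=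
          (Finset.union_subset_union_left (Finset.erase_subset w τ)).trans hτ.2.1
        rw [hold _ (hins _ hd hsub).1 (hins _ hd hsub).2]
        refine fun h => (hold _ hd hsub).1 hX' fun x hx => ?_
        have := h hx
        rw [Finset.mem_coe, Finset.insert_union, Finset.mem_insert] at this
        exact this.resolve_left fun h' => hvres (h' ▸ hx)
    · push Not at hv
      -- no apex: a new face together with `σ` is all of `F K`, so it has too many vertices
      have hempty : ∀ τ ∈ N, τ.card ≠ m := by
        rintro τ ⟨hd, hτ, hr⟩ rfl
        have hFK : F K ⊆ τ ∪ σ := fun x hx => by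
          by_cases hxr : x ∈ res
          · exact hr hxr
          · exact Finset.mem_union_right _ (hv x hx hxr)
        have := Finset.card_le_card hFK
        rw [hcard, Finset.card_union_of_disjoint hd] at this
        omega
      obtain ⟨b, hb, hb0⟩ := ih c (fun τ hτ =>
        ⟨(hc hτ).1.resolve_right fun h => hempty τ h (hc hτ).2, (hc hτ).2⟩) hc0
      exact ⟨b, fun τ hτ => ⟨Or.inl (hb hτ).1, (hb hτ).2⟩, hb0⟩

/-- A complex with a shelling order is Cohen–Macaulay over every ring. That every face lies in a
facet is automatic for finite complexes, but not in general. -/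
theorem IsShellingOrder.isCohenMacaulay {D : FaceComplex V} {s : ℕ} {F : Fin s → Finset V}
    (h : D.IsShellingOrder F) (hD : ∀ G ∈ D.faces, ∃ k, G ⊆ F k)
    (R : Type*) [CommRing R] : D.IsCohenMacaulay R := by
  obtain ⟨hpure, -, hrange, hF⟩ := h
  have hfacet : ∀ k, F k ∈ D.facets := fun k => hrange ▸ Set.mem_range_self k
  rintro σ - m ⟨τ, ⟨hτσ, hτ⟩, hm⟩ c hc hc0
  obtain ⟨k₀, hk₀⟩ := hD _ hτ
  have hlt : m + σ.card < (F k₀).card := by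
    have := Finset.card_le_card hk₀
    rw [Finset.card_union_of_disjoint hτσ] at this
    omega
  have hfaces : (D.link σ).faces =
      {τ | Disjoint τ σ ∧ ∃ i : Fin s, i.1 < s ∧ τ ∪ σ ⊆ F i} := by
    ext ρ
    constructor
    · rintro ⟨hd, hρ⟩
      obtain ⟨k, hk⟩ := hD _ hρ
      exact ⟨hd, k, k.2, hk⟩
    · rintro ⟨hd, i, -, hρ⟩
      exact ⟨hd, D.down_closed _ (hfacet i).prop _ hρ⟩
  simp only [chains, hfaces] at hc ⊢
  exact exists_boundary_of_shelling (fun k => hpure _ (hfacet k) _ (hfacet k₀)) hF σ hlt s le_rfl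
    c hc hc0

end FaceComplex

namespace Matroid

open Set

section Activity

variable {α : Type*} {M : Matroid α} {B I J X Y T : Set α} {b c e f g i : α}

/-! ### Exchange in a basis -/

lemma mem_groundFinset [M.Finite] {S : Set α} : e ∈ M.groundFinset S ↔ e ∈ M.E ∧ e ∈ S := by
  simp [groundFinset]

/-- For a basis `B`, an element `b ∈ B` and `e ∉ B`: the set obtained from `B` by replacing `b`
with `e` is a basis. Equivalently, `b` lies in the fundamental circuit of `e`, and `e` in the
fundamental cocircuit of `b`. -/
def Exchangeable (M : Matroid α) (B : Set α) (b e : α) : Prop := e ∉ M.closure (B \ {b})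

lemma coe_groundFinset [M.Finite] {S : Set α} (hS : S ⊆ M.E) : (M.groundFinset S : Set α) = S := by
  ext e
  rw [Finset.mem_coe, mem_groundFinset]
  exact and_iff_right_of_imp fun h => hS h

lemma card_groundFinset [M.Finite] {S : Set α} (hS : S ⊆ M.E) :
    (M.groundFinset S).card = S.ncard := by
  rw [← Set.ncard_coe_finset, coe_groundFinset hS]

lemma mem_dual_closure_iff (he : e ∈ M.E) (heX : e ∉ X) :
    e ∈ M✶.closure X ↔ e ∉ M.closure (M.E \ insert e X) := by
  constructor
  · intro h h'
    obtain ⟨K, hKX, hK, heK⟩ := exists_isCircuit_of_mem_closure h heX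
    obtain ⟨C, hCX, hC, heC⟩ := exists_isCircuit_of_mem_closure h' (by simp)
    refine hC.inter_isCocircuit_ne_singleton (K := K) (e := e) hK ?_
    ext x
    constructor
    · rintro ⟨hxC, hxK⟩
      rcases hCX hxC with rfl | hx
      · rfl
      · exact (hx.2 (hKX hxK)).elim
    · rintro rfl
      exact ⟨heC, heK⟩
  · intro h
    -- extend a basis of the complement of `X ∪ e` by `e` to a basis of the matroid
    obtain ⟨I, hI⟩ := M.exists_isBasis (M.E \ insert e X)
    have heI : e ∉ I := fun h' => (hI.subset h').2 (mem_insert _ _)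
    have hind : M.Indep (insert e I) := by
      rw [hI.indep.insert_indep_iff_of_notMem heI, hI.closure_eq_closure]
      exact ⟨he, h⟩
    obtain ⟨B, hB, hIB⟩ := hind.exists_isBase_superset
    have heB : e ∈ B := hIB (mem_insert _ _)
    rw [mem_closure_iff_exists_isCircuit heX]
    refine ⟨M.E \ M.closure (B \ {e}), fun x hx => ?_,
      hB.compl_closure_sdiff_singleton_isCocircuit heB, he,
      hB.indep.notMem_closure_sdiff_of_mem heB⟩
    by_contra hxX
    have hx' : x ∈ M.closure I := hI.closure_eq_closure ▸
      M.mem_closure_of_mem (X := M.E \ insert e X) ⟨hx.1, hxX⟩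
    have hIB' : I ⊆ B \ {e} := fun y hy =>
      ⟨hIB (mem_insert_of_mem _ hy), fun h => heI (h ▸ hy)⟩
    exact hx.2 (M.closure_subset_closure hIB' hx')

lemma IsBase.mem_closure_sdiff (hB : M.IsBase B) (he : e ∈ M.E)
    (h : ∀ f ∈ T, ¬ M.Exchangeable B f e) : e ∈ M.closure (B \ T) := by
  rcases T.eq_empty_or_nonempty with rfl | hT
  · rwa [sdiff_empty, hB.closure_eq]
  · have : Nonempty T := hT.to_subtype
    have hBT : B \ T = ⋂ f : T, B \ {f.1} := by
      ext x
      simp only [mem_sdiff, mem_iInter, mem_singleton_iff, Subtype.forall]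
      exact ⟨fun hx f hf => ⟨hx.1, fun h => hx.2 (h ▸ hf)⟩, fun hx =>
        ⟨(hx _ hT.some_mem).1, fun hxT => (hx x hxT).2 rfl⟩⟩
    rw [hBT, hB.indep.closure_iInter_eq_biInter_closure_of_forall_subset fun _ => sdiff_subset]
    exact mem_iInter.2 fun f => not_not.1 (h f.1 f.2)

lemma Indep.mem_closure_sdiff_sdiff (hJ : M.Indep J) (hf : f ∈ M.closure (J \ {b}))
    (hg : f ∈ M.closure (J \ {g})) : f ∈ M.closure ((J \ {b}) \ {g}) := by
  have h : (J \ {b}) \ {g} = (J \ {b}) ∩ (J \ {g}) := by ext; simp; tauto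
  rw [h, Indep.closure_inter_eq_inter_closure
    (hJ.subset (union_subset sdiff_subset sdiff_subset))]
  exact ⟨hf, hg⟩

lemma insert_sdiff_sdiff_self (hc : c ∉ B) : insert c (B \ {b}) \ {c} = B \ {b} := by
  rw [insert_sdiff_self_of_notMem fun h => hc h.1]

lemma insert_sdiff_sdiff_of_ne (hgc : g ≠ c) :
    insert c (B \ {b}) \ {g} = insert c ((B \ {b}) \ {g}) :=
  insert_sdiff_singleton_comm hgc.symm _ |>.symm

lemma sdiff_eq_insert_sdiff_sdiff (hb : b ∈ B) (hgb : g ≠ b) :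
    B \ {g} = insert b ((B \ {b}) \ {g}) := by
  ext x
  simp only [mem_sdiff, mem_singleton_iff, mem_insert_iff]
  constructor
  · rintro ⟨h1, h2⟩
    by_cases hx : x = b
    · exact Or.inl hx
    · exact Or.inr ⟨⟨h1, hx⟩, h2⟩
  · rintro (rfl | h)
    · exact ⟨hb, hgb.symm⟩
    · exact ⟨h.1.1, h.2⟩

lemma exchangeable_pivot_new (hc : c ∉ B) :
    M.Exchangeable (insert c (B \ {b})) c f ↔ M.Exchangeable B b f := by
  rw [Exchangeable, Exchangeable, insert_sdiff_sdiff_self hc]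

lemma IsBase.exchangeable_self (hB : M.IsBase B) (hb : b ∈ B) : M.Exchangeable B b b :=
  hB.indep.notMem_closure_sdiff_of_mem hb

lemma IsBase.pivot (hB : M.IsBase B) (hb : b ∈ B) (hc : c ∈ M.E \ B)
    (hbc : M.Exchangeable B b c) : M.IsBase (insert c (B \ {b})) :=
  hB.exchange_base_of_notMem_closure hb hbc hc.1

lemma IsBase.exchangeable_pivot_of_not_left (hB : M.IsBase B) (hb : b ∈ B) (hc : c ∈ M.E \ B)
    (hbc : M.Exchangeable B b c) (hg : g ∈ B) (hbf : ¬ M.Exchangeable B b f) :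
    M.Exchangeable (insert c (B \ {b})) g f ↔ M.Exchangeable B g f := by
  have hgc : g ≠ c := fun h => hc.2 (h ▸ hg)
  have hbf' : f ∈ M.closure (B \ {b}) := not_not.1 hbf
  refine not_congr ⟨fun h => ?_, fun h => ?_⟩
  · have h' := (hB.pivot hb hc hbc).indep.mem_closure_sdiff_sdiff (b := c) (f := f)
      (by rwa [insert_sdiff_sdiff_self hc.2]) h
    rw [insert_sdiff_sdiff_self hc.2] at h'
    exact M.closure_subset_closure (sdiff_subset_sdiff_left sdiff_subset) h'
  · exact M.closure_subset_closure (sdiff_subset_sdiff_left (subset_insert _ _))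
      (hB.indep.mem_closure_sdiff_sdiff hbf' h)

lemma exchangeable_pivot_of_not_right (hb : b ∈ B) (hc : c ∈ M.E \ B)
    (hbc : M.Exchangeable B b c) (hg : g ∈ B) (hgb : g ≠ b) (hgc : ¬ M.Exchangeable B g c) :
    M.Exchangeable (insert c (B \ {b})) g f ↔ M.Exchangeable B g f := by
  rw [Exchangeable, Exchangeable, insert_sdiff_sdiff_of_ne (ne_of_mem_of_not_mem hg hc.2),
    sdiff_eq_insert_sdiff_sdiff hb hgb, closure_insert_congr]
  rw [← sdiff_eq_insert_sdiff_sdiff hb hgb]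
  exact ⟨not_not.1 hgc, fun h => hbc (M.closure_subset_closure sdiff_subset h)⟩

lemma IsBase.exchangeable_pivot_old (hB : M.IsBase B) (hb : b ∈ B) (hc : c ∈ M.E \ B)
    (hbc : M.Exchangeable B b c) (hg : g ∈ B) (hgb : g ≠ b) :
    M.Exchangeable (insert c (B \ {b})) g b ↔ M.Exchangeable B g c := by
  rw [Exchangeable, Exchangeable, insert_sdiff_sdiff_of_ne (ne_of_mem_of_not_mem hg hc.2),
    sdiff_eq_insert_sdiff_sdiff hb hgb]
  have h := M.closure_exchange_iff (e := b) (f := c) (X := (B \ {b}) \ {g})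
  have hb' : b ∉ M.closure ((B \ {b}) \ {g}) := fun h =>
    hB.indep.notMem_closure_sdiff_of_mem hb (M.closure_subset_closure sdiff_subset h)
  have hc' : c ∉ M.closure ((B \ {b}) \ {g}) := fun h =>
    hbc (M.closure_subset_closure sdiff_subset h)
  rw [mem_sdiff, mem_sdiff, and_iff_left hb', and_iff_left hc'] at h
  exact not_congr h

/-! ### Activities in terms of closures and exchanges -/

variable [LinearOrder α]

lemma mem_extActive_iff {S : Set α} :
    e ∈ M.extActive S ↔ e ∈ M.E \ S ∧ e ∈ M.closure (S ∩ Iio e) := by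
  constructor
  · rintro ⟨he, C, hC, hCS, hmax⟩
    refine ⟨he, M.closure_subset_closure (fun x hx => ?_)
      (hC.mem_closure_sdiff_singleton_of_mem hmax.1)⟩
    exact ⟨(hCS hx.1).resolve_left hx.2, lt_of_le_of_ne (hmax.2 hx.1) hx.2⟩
  · rintro ⟨he, hcl⟩
    obtain ⟨C, hCS, hC, heC⟩ := exists_isCircuit_of_mem_closure hcl (fun h => he.2 h.1)
    refine ⟨he, C, hC, hCS.trans (insert_subset_insert inter_subset_left), heC, fun x hx => ?_⟩
    rcases hCS hx with rfl | h
    · exact le_rfl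
    · exact h.2.le

lemma mem_intActive_iff {S : Set α} (hS : S ⊆ M.E) :
    i ∈ M.intActive S ↔ i ∈ S ∧ i ∉ M.closure (S \ {i} ∪ Ioi i) := by
  refine and_congr_right fun hi => ?_
  have hset : M.E \ insert i ((M.E \ S) ∩ Iio i) = (S \ {i} ∪ Ioi i) ∩ M.E := by
    ext x
    simp only [mem_sdiff, mem_insert_iff, mem_inter_iff, mem_union, mem_singleton_iff,
      Set.mem_Iio, Set.mem_Ioi]
    constructor
    · rintro ⟨hx, hn⟩
      push Not at hn
      refine ⟨?_, hx⟩
      by_cases hxS : x ∈ S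
      · exact Or.inl ⟨hxS, hn.1⟩
      · exact Or.inr (lt_of_le_of_ne (hn.2 ⟨hx, hxS⟩) (Ne.symm hn.1))
    · rintro ⟨h | h, hx⟩
      · exact ⟨hx, fun h' => h'.elim h.2 fun h' => h'.1.2 h.1⟩
      · exact ⟨hx, fun h' => h'.elim h.ne' fun h' => h'.2.not_gt h⟩
  rw [mem_extActive_iff, mem_dual_closure_iff (hS hi)
    (fun h => h.1.2 hi), hset, closure_inter_ground]
  exact and_iff_right ⟨hS hi, fun h => h.2 hi⟩

lemma IsBase.mem_extActive_iff (hB : M.IsBase B) :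
    e ∈ M.extActive B ↔ e ∈ M.E \ B ∧ ∀ b ∈ B, M.Exchangeable B b e → b < e := by
  rw [Matroid.mem_extActive_iff]
  refine and_congr_right fun he => ⟨fun h b _ hbe => ?_, fun h => ?_⟩
  · by_contra hlt
    have hsub : B ∩ Iio e ⊆ B \ {b} := fun x hx => ⟨hx.1, fun h => hlt (h ▸ hx.2)⟩
    exact hbe (M.closure_subset_closure hsub h)
  · have := hB.mem_closure_sdiff (T := B \ Iio e) he.1 fun f hf hfe => hf.2 (h f hf.1 hfe)
    rwa [Set.sdiff_sdiff_right_self] at this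

lemma IsBase.mem_intActive_iff (hB : M.IsBase B) :
    i ∈ M.intActive B ↔ i ∈ B ∧ ∀ e ∈ M.E \ B, M.Exchangeable B i e → e < i := by
  rw [Matroid.mem_intActive_iff hB.subset_ground]
  refine and_congr_right fun hi => ⟨fun h e he hie => ?_, fun h hcl => ?_⟩
  · by_contra hlt
    have hei : i < e := lt_of_le_of_ne (not_lt.1 hlt) fun h => he.2 (h ▸ hi)
    have hcl : e ∈ M.closure (insert i (B \ {i})) := by
      rw [insert_sdiff_singleton, insert_eq_of_mem hi, hB.closure_eq]; exact he.1
    refine h (M.closure_subset_closure ?_ (M.mem_closure_insert hie hcl))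
    exact insert_subset (Or.inr hei) subset_union_left
  · refine hB.indep.notMem_closure_sdiff_of_mem hi ?_
    rw [← closure_inter_ground] at hcl
    refine M.closure_subset_closure_of_subset_closure (fun x hx => ?_) hcl
    rcases hx with ⟨hx | hx, hxE⟩
    · exact M.mem_closure_of_mem hx (sdiff_subset.trans hB.subset_ground)
    · by_cases hxB : x ∈ B
      · exact M.mem_closure_of_mem ⟨hxB, ne_of_gt hx⟩ (sdiff_subset.trans hB.subset_ground)
      · by_contra hxc
        exact lt_asymm hx (h x ⟨hxE, hxB⟩ hxc)

/-- The fundamental circuit of `e` contains no internally active element below `e`. -/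
lemma IsBase.mem_closure_sdiff_intActive (hB : M.IsBase B) (hY : Y ⊆ M.intActive B)
    (he : e ∈ M.E \ B) : e ∈ M.closure (B \ (Y ∩ Iio e)) :=
  hB.mem_closure_sdiff he.1 fun _ hf hfe =>
    lt_asymm hf.2 ((hB.mem_intActive_iff.1 (hY hf.1)).2 e he hfe)

/-! ### The decomposition of an independent set -/

section Decomp

variable {B' Y' : Set α}

lemma IsIntDecomp.isBase (h : M.IsIntDecomp I B Y) : M.IsBase B := h.1

lemma IsIntDecomp.subset (h : M.IsIntDecomp I B Y) : I ⊆ B := h.2.2 ▸ sdiff_subset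

lemma IsIntDecomp.deleted_subset (h : M.IsIntDecomp I B Y) : Y ⊆ B := fun _ hy => (h.2.1 hy).1

lemma IsIntDecomp.indep (h : M.IsIntDecomp I B Y) : M.Indep I := h.isBase.indep.subset h.subset

lemma IsIntDecomp.union_eq (h : M.IsIntDecomp I B Y) : I ∪ Y = B := by
  rw [h.2.2, sdiff_union_self, union_eq_left.2 h.deleted_subset]

/-- The deleted set `Y` in terms of `I = B \ Y` alone; hence the uniqueness of the
decomposition. -/
lemma IsIntDecomp.deleted_eq (h : M.IsIntDecomp I B Y) :
    Y = {e | e ∈ M.E \ I ∧ e ∉ M.closure (I ∪ Ioi e)} := by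
  ext e
  constructor
  · intro he
    have heB := h.deleted_subset he
    refine ⟨⟨h.isBase.subset_ground heB, fun heI => (h.2.2 ▸ heI).2 he⟩, fun hcl => ?_⟩
    refine ((Matroid.mem_intActive_iff h.isBase.subset_ground).1 (h.2.1 he)).2
      (M.closure_subset_closure (union_subset_union_left _ fun x hx => ?_) hcl)
    exact ⟨h.subset hx, fun hxe => (h.2.2 ▸ hx).2 (hxe ▸ he)⟩
  · rintro ⟨⟨heE, heI⟩, hcl⟩
    by_cases heB : e ∈ B
    · by_contra heY
      exact heI (h.2.2 ▸ ⟨heB, heY⟩)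
    · refine (hcl (M.closure_subset_closure (fun x hx => ?_)
        (h.isBase.mem_closure_sdiff_intActive h.2.1 ⟨heE, heB⟩))).elim
      by_cases hxY : x ∈ Y
      · refine Or.inr (lt_of_le_of_ne (not_lt.1 fun hlt => hx.2 ⟨hxY, hlt⟩) ?_)
        exact fun hex => heB (hex ▸ hx.1)
      · exact Or.inl (h.2.2 ▸ ⟨hx.1, hxY⟩)

lemma IsIntDecomp.deleted_unique (h : M.IsIntDecomp I B Y) (h' : M.IsIntDecomp I B' Y') :
    Y = Y' := by
  rw [h.deleted_eq, h'.deleted_eq]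

lemma IsIntDecomp.base_unique (h : M.IsIntDecomp I B Y) (h' : M.IsIntDecomp I B' Y') :
    B = B' := by
  rw [← h.union_eq, ← h'.union_eq, h.deleted_unique h']

/-- The basis in the decomposition is the colexicographically largest basis containing `I`: an
element of `B \ I` that is not internally active could be exchanged for a larger one. -/
lemma Indep.exists_isIntDecomp [M.Finite] (hI : M.Indep I) : ∃ B Y, M.IsIntDecomp I B Y := by
  have hfin : {B | M.IsBase B ∧ I ⊆ B}.Finite :=
    M.ground_finite.finite_subsets.subset fun B hB => hB.1.subset_ground
  obtain ⟨B, ⟨hB, hIB⟩, hmax⟩ := hfin.exists_maximalFor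
    (fun B => toColex (M.groundFinset B)) _ hI.exists_isBase_superset
  refine ⟨B, B \ I, hB, fun y hy => hB.mem_intActive_iff.2 ⟨hy.1, fun e he hye => ?_⟩,
    by rw [Set.sdiff_sdiff_right_self, inter_eq_right.2 hIB]⟩
  by_contra hlt
  have hlt : y < e := lt_of_le_of_ne (not_lt.1 hlt) fun h => he.2 (h ▸ hy.1)
  have hcolex : toColex (M.groundFinset B) < toColex (M.groundFinset (insert e (B \ {y}))) := by
    rw [Finset.Colex.toColex_lt_toColex_iff_exists_forall_lt]
    refine ⟨e, mem_groundFinset.2 ⟨he.1, mem_insert _ _⟩,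
      fun h => he.2 (mem_groundFinset.1 h).2, fun x hx hx' => ?_⟩
    obtain ⟨hxE, hxB⟩ := mem_groundFinset.1 hx
    have : x = y := by
      by_contra hxy
      exact hx' (mem_groundFinset.2 ⟨hxE, Or.inr ⟨hxB, hxy⟩⟩)
    rwa [this]
  exact hcolex.not_ge (hmax ⟨hB.pivot hy.1 he hye, fun x hx =>
    Or.inr ⟨hIB hx, fun h => hy.2 (h ▸ hx)⟩⟩ hcolex.le)

lemma IsIntDecomp.intDeleted_eq (h : M.IsIntDecomp I B Y) : M.intDeleted I = Y := by
  ext e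
  constructor
  · rintro ⟨B', Y', h', he⟩
    exact h'.deleted_unique h ▸ he
  · exact fun he => ⟨B, Y, h, he⟩

/-- Deleting internally active elements does not change the external activity, since the
fundamental circuit of an externally active element contains no internally active element. -/
lemma IsIntDecomp.extActive_eq (h : M.IsIntDecomp I B Y) : M.extActive I = M.extActive B := by
  ext e
  rw [Matroid.mem_extActive_iff, Matroid.mem_extActive_iff]
  constructor
  · rintro ⟨⟨heE, heI⟩, hcl⟩
    have hsub : I ∩ Iio e ⊆ B \ {e} := fun x hx =>
      ⟨h.subset hx.1, fun hxe => heI (hxe ▸ hx.1)⟩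
    exact ⟨⟨heE, fun heB => h.isBase.indep.notMem_closure_sdiff_of_mem heB
        (M.closure_subset_closure hsub hcl)⟩,
      M.closure_subset_closure (inter_subset_inter_left _ h.subset) hcl⟩
  · rintro ⟨heB, hcl⟩
    refine ⟨⟨heB.1, fun heI => heB.2 (h.subset heI)⟩, ?_⟩
    have h' := h.isBase.mem_closure_sdiff_intActive h.2.1 heB
    have hinter : I ∩ Iio e = (B ∩ Iio e) ∩ (B \ (Y ∩ Iio e)) := by
      rw [h.2.2]; ext x; simp only [mem_inter_iff, mem_sdiff, Set.mem_Iio]; tauto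
    rw [hinter, Indep.closure_inter_eq_inter_closure
      (h.isBase.indep.subset (union_subset inter_subset_left sdiff_subset))]
    exact ⟨hcl, h'⟩

lemma IsIntDecomp.sdiff_intActive_eq (h : M.IsIntDecomp I B Y) :
    I \ M.intActive I = B \ M.intActive B := by
  have hIE := h.subset.trans h.isBase.subset_ground
  have key : ∀ i ∈ I, (i ∈ M.intActive I ↔ i ∈ M.intActive B) := by
    intro i hi
    constructor
    · intro hiI
      rw [h.isBase.mem_intActive_iff]
      refine ⟨h.subset hi, fun e he hie => ?_⟩
      by_contra hlt
      have hlt : i < e := lt_of_le_of_ne (not_lt.1 hlt) fun h' => he.2 (h' ▸ h.subset hi)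
      -- the fundamental circuit of `e` contains `i`, and its elements outside `I` exceed `e`
      set A := B \ (Y ∩ Iio e)
      have hiA : i ∈ A := ⟨h.subset hi, fun h' => (h.2.2 ▸ hi).2 h'.1⟩
      have heA : e ∈ M.closure (insert i (A \ {i})) := by
        rw [insert_sdiff_singleton, insert_eq_of_mem hiA]
        exact h.isBase.mem_closure_sdiff_intActive h.2.1 he
      have heA' : e ∉ M.closure (A \ {i}) := fun h' =>
        hie (M.closure_subset_closure (sdiff_subset_sdiff_left sdiff_subset) h')
      refine ((Matroid.mem_intActive_iff hIE).1 hiI).2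
        (M.closure_subset_closure ?_ (M.mem_closure_insert heA' heA))
      refine insert_subset (Or.inr hlt) fun x hx => ?_
      by_cases hxY : x ∈ Y
      · exact Or.inr (hlt.trans_le (not_lt.1 fun hxe => hx.1.2 ⟨hxY, hxe⟩))
      · exact Or.inl ⟨h.2.2 ▸ ⟨hx.1.1, hxY⟩, hx.2⟩
    · intro hiB
      refine (Matroid.mem_intActive_iff hIE).2 ⟨hi, fun hcl => ?_⟩
      exact ((Matroid.mem_intActive_iff h.isBase.subset_ground).1 hiB).2
        (M.closure_subset_closure
          (union_subset_union_left _ (sdiff_subset_sdiff_left h.subset)) hcl)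
  ext i
  constructor
  · exact fun hi => ⟨h.subset hi.1, fun h' => hi.2 ((key i hi.1).2 h')⟩
  · intro hi
    have hiI : i ∈ I := h.2.2 ▸ ⟨hi.1, fun h' => hi.2 (h.2.1 h')⟩
    exact ⟨hiI, fun h' => hi.2 ((key i hiI).1 h')⟩

/-! ### The external/internal order -/

/-- The union of the internally passive and the externally active elements of `B`. -/
def extIntSet (M : Matroid α) (B : Set α) : Set α := (B \ M.intActive B) ∪ M.extActive B

/-- The decomposition deleting all internally active elements. -/
lemma IsBase.isIntDecomp_sdiff_intActive (hB : M.IsBase B) :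
    M.IsIntDecomp (B \ M.intActive B) B (M.intActive B) := ⟨hB, Subset.rfl, rfl⟩

lemma union_extActive_inter_Iio_subset_closure (hB : B ⊆ M.E) (e : α) :
    (B ∪ M.extActive B) ∩ Iio e ⊆ M.closure (B ∩ Iio e) := by
  rintro x ⟨hx | hx, hxe⟩
  · exact M.mem_closure_of_mem ⟨hx, hxe⟩ (inter_subset_left.trans hB)
  · exact M.closure_subset_closure (inter_subset_inter_right _ (Iio_subset_Iio (le_of_lt hxe)))
      (Matroid.mem_extActive_iff.1 hx).2

lemma IsBase.extActive_subset_of_subset (hB : M.IsBase B) (hB' : M.IsBase B')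
    (h : B \ M.intActive B ⊆ B' ∪ M.extActive B') : M.extActive B ⊆ M.extActive B' := by
  intro e he
  rw [← hB.isIntDecomp_sdiff_intActive.extActive_eq, Matroid.mem_extActive_iff] at he
  have hcl : e ∈ M.closure (B' ∩ Iio e) :=
    M.closure_subset_closure_of_subset_closure ((inter_subset_inter_left _ h).trans
      (union_extActive_inter_Iio_subset_closure hB'.subset_ground e)) he.2
  refine Matroid.mem_extActive_iff.2 ⟨⟨he.1.1, fun heB' => ?_⟩, hcl⟩
  have hsub : B' ∩ Iio e ⊆ B' \ {e} := fun x hx => ⟨hx.1, ne_of_lt hx.2⟩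
  exact hB'.indep.notMem_closure_sdiff_of_mem heB' (M.closure_subset_closure hsub hcl)

/-- The containment of the internally passive elements of `B` in `B' ∪ EA(B')` already forces `B`
to be below `B'`. -/
lemma IsBase.extIntSet_subset_of_subset (hB : M.IsBase B) (hB' : M.IsBase B')
    (h : B \ M.intActive B ⊆ B' ∪ M.extActive B') : M.extIntSet B ⊆ M.extIntSet B' := by
  rintro b (hb | hb)
  · rcases h hb with hbB' | hbE
    · refine Or.inl ⟨hbB', fun hbI => ?_⟩
      refine ((Matroid.mem_intActive_iff hB'.subset_ground).1 hbI).2 ?_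
      -- a larger `c` whose fundamental circuit contains `b`
      obtain ⟨c, hc, hbc, hlt⟩ : ∃ c ∈ M.E \ B, M.Exchangeable B b c ∧ ¬ c < b := by
        by_contra! hcon
        exact hb.2 (hB.mem_intActive_iff.2 ⟨hb.1, hcon⟩)
      have hlt : b < c := lt_of_le_of_ne (not_lt.1 hlt) fun h' => hc.2 (h' ▸ hb.1)
      set A := B \ (M.intActive B ∩ Iio c)
      have hbA : b ∈ A := ⟨hb.1, fun h' => hb.2 h'.1⟩
      have hcA : c ∈ M.closure (insert b (A \ {b})) := by
        rw [insert_sdiff_singleton, insert_eq_of_mem hbA]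
        exact hB.mem_closure_sdiff_intActive Subset.rfl hc
      have hcA' : c ∉ M.closure (A \ {b}) := fun h' =>
        hbc (M.closure_subset_closure (sdiff_subset_sdiff_left sdiff_subset) h')
      have hground : ∀ x ∈ M.E, x ∈ Ioi b → x ∈ M.closure (B' \ {b} ∪ Ioi b) := fun x hx hxb =>
        M.mem_closure_of_mem' (Or.inr hxb) hx
      refine M.closure_subset_closure_of_subset_closure ?_ (M.mem_closure_insert hcA' hcA)
      refine insert_subset (hground c hc.1 hlt) fun x hx => ?_
      have hxE : x ∈ M.E := hB.subset_ground hx.1.1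
      rcases lt_or_gt_of_ne (show x ≠ b from hx.2) with hxb | hxb
      · have hxP : x ∈ B \ M.intActive B :=
          ⟨hx.1.1, fun h' => hx.1.2 ⟨h', hxb.trans hlt⟩⟩
        have hsub : B' ∩ Iio b ⊆ B' \ {b} ∪ Ioi b := fun y hy => Or.inl ⟨hy.1, ne_of_lt hy.2⟩
        exact M.closure_subset_closure hsub
          (union_extActive_inter_Iio_subset_closure hB'.subset_ground b ⟨h hxP, hxb⟩)
      · exact hground x hxE hxb
    · exact Or.inr hbE
  · exact Or.inr (hB.extActive_subset_of_subset hB' h hb)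

lemma extIntSet_subset_union (M : Matroid α) (B : Set α) :
    M.extIntSet B ⊆ B ∪ M.extActive B := union_subset_union_left _ sdiff_subset

lemma IsBase.eq_of_extIntSet_eq (hB : M.IsBase B) (hB' : M.IsBase B')
    (h : M.extIntSet B = M.extIntSet B') : B = B' := by
  have hsub := subset_union_left.trans (h.subset.trans (M.extIntSet_subset_union B'))
  have hsub' := subset_union_left.trans (h.symm.subset.trans (M.extIntSet_subset_union B))
  have hE : M.extActive B = M.extActive B' :=
    (hB.extActive_subset_of_subset hB' hsub).antisymm (hB'.extActive_subset_of_subset hB hsub')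
  have hP : ∀ A, A \ M.intActive A = M.extIntSet A \ M.extActive A := fun A => by
    rw [extIntSet, union_sdiff_right]
    refine (sdiff_eq_left.2 (disjoint_left.2 fun x hx hx' => hx'.1.2 hx.1)).symm
  have hd := hB.isIntDecomp_sdiff_intActive
  rw [hP B, h, hE, ← hP B'] at hd
  exact hd.base_unique hB'.isIntDecomp_sdiff_intActive

lemma IsIntDecomp.intRelated_iff (hI : M.IsIntDecomp I B Y) (hJ : M.IsIntDecomp J B' Y') :
    M.IntRelated I J ↔ B = B' := by
  constructor
  · rintro ⟨B₀, Y₀, Y₁, h₀, h₁⟩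
    rw [hI.base_unique h₀, hJ.base_unique h₁]
  · rintro rfl
    exact ⟨B, Y, Y', hI, hJ⟩

lemma IsIntDecomp.extIntLE_iff (hI : M.IsIntDecomp I B Y) (hJ : M.IsIntDecomp J B' Y') :
    M.ExtIntLE I J ↔ B ≠ B' ∧ M.extIntSet B ⊆ M.extIntSet B' ∨ B = B' ∧ I ⊆ J := by
  rw [ExtIntLE, hI.intRelated_iff hJ, hI.sdiff_intActive_eq, hJ.sdiff_intActive_eq,
    hI.extActive_eq, hJ.extActive_eq]
  rfl

lemma IsIntDecomp.extIntLE_of_subset_union (hI : M.IsIntDecomp I B Y)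
    (hJ : M.IsIntDecomp J B' Y') (h : I ⊆ J ∪ M.extActive B') : M.ExtIntLE I J := by
  rw [hI.extIntLE_iff hJ]
  by_cases hBB : B = B'
  · subst hBB
    exact Or.inr ⟨rfl, fun x hx => (h hx).resolve_right fun h' => h'.1.2 (hI.subset hx)⟩
  · refine Or.inl ⟨hBB, hI.isBase.extIntSet_subset_of_subset hJ.isBase fun x hx => ?_⟩
    rw [← hI.sdiff_intActive_eq] at hx
    exact union_subset_union_left _ hJ.subset (h hx.1)

variable [M.Finite]

lemma Indep.extIntLE_refl (hI : M.Indep I) : M.ExtIntLE I I := by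
  obtain ⟨B, Y, h⟩ := hI.exists_isIntDecomp
  exact (h.extIntLE_iff h).2 (Or.inr ⟨rfl, Subset.rfl⟩)

lemma Indep.extIntLE_antisymm (hI : M.Indep I) (hJ : M.Indep J) (h : M.ExtIntLE I J)
    (h' : M.ExtIntLE J I) : I = J := by
  obtain ⟨B, Y, hIB⟩ := hI.exists_isIntDecomp
  obtain ⟨B', Y', hJB⟩ := hJ.exists_isIntDecomp
  rw [hIB.extIntLE_iff hJB] at h
  rw [hJB.extIntLE_iff hIB] at h'
  rcases h with ⟨hne, h⟩ | ⟨heq, h⟩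
  · rcases h' with ⟨-, h'⟩ | ⟨heq, -⟩
    · exact (hne (hIB.isBase.eq_of_extIntSet_eq hJB.isBase (h.antisymm h'))).elim
    · exact (hne heq.symm).elim
  · rcases h' with ⟨hne, -⟩ | ⟨-, h'⟩
    · exact (hne heq.symm).elim
    · exact h.antisymm h'

lemma Indep.extIntLE_trans {K : Set α} (hI : M.Indep I) (hJ : M.Indep J) (hK : M.Indep K)
    (h : M.ExtIntLE I J) (h' : M.ExtIntLE J K) : M.ExtIntLE I K := by
  obtain ⟨B, Y, hIB⟩ := hI.exists_isIntDecomp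
  obtain ⟨B', Y', hJB⟩ := hJ.exists_isIntDecomp
  obtain ⟨B'', Y'', hKB⟩ := hK.exists_isIntDecomp
  rw [hIB.extIntLE_iff hJB] at h
  rw [hJB.extIntLE_iff hKB] at h'
  rw [hIB.extIntLE_iff hKB]
  rcases h with ⟨hne, h⟩ | ⟨rfl, h⟩
  · rcases h' with ⟨hne', h'⟩ | ⟨rfl, -⟩
    · refine Or.inl ⟨?_, h.trans h'⟩
      rintro rfl
      exact hne (hIB.isBase.eq_of_extIntSet_eq hJB.isBase (h.antisymm h'))
    · exact Or.inl ⟨hne, h⟩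
  · rcases h' with h' | ⟨rfl, h'⟩
    · exact Or.inl h'
    · exact Or.inr ⟨rfl, h.trans h'⟩

end Decomp

/-! ### Pivots going down in the external/internal order -/

/-- Replacing `b` by the smallest externally active element that it can be exchanged for. -/
lemma IsBase.pivot_extActive (hB : M.IsBase B) (hb : b ∈ B) (hc : c ∈ M.extActive B)
    (hbc : M.Exchangeable B b c) (hmin : ∀ f ∈ M.extActive B, M.Exchangeable B b f → c ≤ f) :
    M.extActive (insert c (B \ {b})) = M.extActive B \ {c} ∧
      M.intActive B ⊆ M.intActive (insert c (B \ {b})) := by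
  have hcB := hc.1
  have hc' := (hB.mem_extActive_iff.1 hc).2
  have hlt : b < c := hc' b hb hbc
  have hB' := hB.pivot hb hcB hbc
  constructor
  · ext f
    constructor
    · intro hf
      rw [hB'.mem_extActive_iff] at hf
      obtain ⟨⟨hfE, hfB'⟩, hf⟩ := hf
      have hfc : f ≠ c := fun h => hfB' (h ▸ mem_insert _ _)
      have hfb : f ≠ b := by
        rintro rfl
        exact lt_asymm hlt (hf c (mem_insert _ _)
          ((exchangeable_pivot_new hcB.2).2 (hB.exchangeable_self hb)))
      have hfB : f ∉ B := fun h => hfB' (Or.inr ⟨h, hfb⟩)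
      refine ⟨hB.mem_extActive_iff.2 ⟨⟨hfE, hfB⟩, fun g hg hgf => ?_⟩, hfc⟩
      by_cases hbf : M.Exchangeable B b f
      · have hcf : c < f := hf c (mem_insert _ _) ((exchangeable_pivot_new hcB.2).2 hbf)
        rcases eq_or_ne g b with rfl | hgb
        · exact hlt.trans hcf
        by_cases hgc : M.Exchangeable B g c
        · exact (hc' g hg hgc).trans hcf
        · exact hf g (Or.inr ⟨hg, hgb⟩)
            ((exchangeable_pivot_of_not_right hb hcB hbc hg hgb hgc).2 hgf)
      · have hgb : g ≠ b := fun h => hbf (h ▸ hgf)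
        exact hf g (Or.inr ⟨hg, hgb⟩)
          ((hB.exchangeable_pivot_of_not_left hb hcB hbc hg hbf).2 hgf)
    · rintro ⟨hf, hfc⟩
      have hf' := (hB.mem_extActive_iff.1 hf).2
      refine hB'.mem_extActive_iff.2 ⟨⟨hf.1.1, ?_⟩, ?_⟩
      · rintro (h | h)
        exacts [hfc h, hf.1.2 h.1]
      rintro g (rfl | ⟨hg, hgb⟩) hgf
      · exact lt_of_le_of_ne (hmin f hf ((exchangeable_pivot_new hcB.2).1 hgf)) (Ne.symm hfc)
      · by_cases hbf : M.Exchangeable B b f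
        · by_cases hgc : M.Exchangeable B g c
          · exact (hc' g hg hgc).trans_le (hmin f hf hbf)
          · exact hf' g hg ((exchangeable_pivot_of_not_right hb hcB hbc hg hgb hgc).1 hgf)
        · exact hf' g hg ((hB.exchangeable_pivot_of_not_left hb hcB hbc hg hbf).1 hgf)
  · intro y hy
    have hy' := (hB.mem_intActive_iff.1 hy).2
    have hyb : y ≠ b := by
      rintro rfl
      exact lt_asymm hlt (hy' c hcB hbc)
    have hyc : ¬ M.Exchangeable B y c := fun h => lt_asymm (hc' y hy.1 h) (hy' c hcB h)
    refine hB'.mem_intActive_iff.2 ⟨Or.inr ⟨hy.1, hyb⟩, fun f hf hyf => ?_⟩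
    rcases eq_or_ne f b with rfl | hfb
    · exact (hyc ((hB.exchangeable_pivot_old hb hcB hbc hy.1 hyb).1 hyf)).elim
    · exact hy' f ⟨hf.1, fun h => hf.2 (Or.inr ⟨h, hfb⟩)⟩
        ((exchangeable_pivot_of_not_right hb hcB hbc hy.1 hyb hyc).1 hyf)

/-- If `b` can be exchanged for no externally active element: replacing it by the largest element
that it can be exchanged for. -/
lemma IsBase.pivot_max (hB : M.IsBase B) (hb : b ∈ B) (hc : c ∈ M.E \ B)
    (hbc : M.Exchangeable B b c) (hlt : b < c)
    (hmax : ∀ f ∈ M.E \ B, M.Exchangeable B b f → f ≤ c)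
    (hnone : ∀ f ∈ M.extActive B, ¬ M.Exchangeable B b f) :
    M.extActive (insert c (B \ {b})) = M.extActive B ∧
      insert c (M.intActive B) ⊆ M.intActive (insert c (B \ {b})) := by
  have hB' := hB.pivot hb hc hbc
  constructor
  · ext f
    constructor
    · intro hf
      rw [hB'.mem_extActive_iff] at hf
      obtain ⟨⟨hfE, hfB'⟩, hf⟩ := hf
      have hfb : f ≠ b := by
        rintro rfl
        exact lt_asymm hlt (hf c (mem_insert _ _)
          ((exchangeable_pivot_new hc.2).2 (hB.exchangeable_self hb)))
      have hfB : f ∉ B := fun h => hfB' (Or.inr ⟨h, hfb⟩)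
      have hbf : ¬ M.Exchangeable B b f := fun hbf =>
        (hf c (mem_insert _ _) ((exchangeable_pivot_new hc.2).2 hbf)).not_ge
          (hmax f ⟨hfE, hfB⟩ hbf)
      refine hB.mem_extActive_iff.2 ⟨⟨hfE, hfB⟩, fun g hg hgf => ?_⟩
      have hgb : g ≠ b := fun h => hbf (h ▸ hgf)
      exact hf g (Or.inr ⟨hg, hgb⟩) ((hB.exchangeable_pivot_of_not_left hb hc hbc hg hbf).2 hgf)
    · intro hf
      have hbf := hnone f hf
      refine hB'.mem_extActive_iff.2 ⟨⟨hf.1.1, ?_⟩, ?_⟩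
      · rintro (rfl | h)
        exacts [hbf hbc, hf.1.2 h.1]
      rintro g (rfl | ⟨hg, hgb⟩) hgf
      · exact (hbf ((exchangeable_pivot_new hc.2).1 hgf)).elim
      · exact (hB.mem_extActive_iff.1 hf).2 g hg
          ((hB.exchangeable_pivot_of_not_left hb hc hbc hg hbf).1 hgf)
  · rintro y (rfl | hy)
    · refine hB'.mem_intActive_iff.2 ⟨mem_insert _ _, fun f hf hyf => ?_⟩
      rcases eq_or_ne f b with rfl | hfb
      · exact hlt
      · refine lt_of_le_of_ne (hmax f ⟨hf.1, fun h => hf.2 (Or.inr ⟨h, hfb⟩)⟩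
          ((exchangeable_pivot_new hc.2).1 hyf)) ?_
        rintro rfl
        exact hf.2 (mem_insert _ _)
    · have hy' := (hB.mem_intActive_iff.1 hy).2
      have hyb : y ≠ b := by
        rintro rfl
        exact lt_asymm hlt (hy' c hc hbc)
      refine hB'.mem_intActive_iff.2 ⟨Or.inr ⟨hy.1, hyb⟩, fun f hf hyf => ?_⟩
      rcases eq_or_ne f b with rfl | hfb
      · exact hlt.trans (hy' c hc ((hB.exchangeable_pivot_old hb hc hbc hy.1 hyb).1 hyf))
      have hfB : f ∈ M.E \ B := ⟨hf.1, fun h => hf.2 (Or.inr ⟨h, hfb⟩)⟩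
      by_cases hyc : M.Exchangeable B y c
      · by_cases hbf : M.Exchangeable B b f
        · exact (hmax f hfB hbf).trans_lt (hy' c hc hyc)
        · exact hy' f hfB ((hB.exchangeable_pivot_of_not_left hb hc hbc hy.1 hbf).1 hyf)
      · exact hy' f hfB ((exchangeable_pivot_of_not_right hb hc hbc hy.1 hyb hyc).1 hyf)

/-- Both pivots go down in the external/internal order: they create no externally active element,
preserve internal activity, and the new element `c` was externally active or is internally active. -/
lemma extIntSet_pivot_subset (hEA : M.extActive (insert c (B \ {b})) ⊆ M.extActive B)
    (hIA : M.intActive B ⊆ M.intActive (insert c (B \ {b})))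
    (hc : c ∈ M.extActive B ∪ M.intActive (insert c (B \ {b}))) :
    M.extIntSet (insert c (B \ {b})) ⊆ M.extIntSet B := by
  rintro x (⟨rfl | hx, hxI⟩ | hx)
  · exact Or.inr (hc.resolve_right hxI)
  · exact Or.inl ⟨hx.1, fun h => hxI (hIA h)⟩
  · exact Or.inr (hEA hx)

end Activity

end Matroid

namespace Matroid

open Set

section Complex

variable {α : Type*} [LinearOrder α] {M : Matroid α} [M.Finite] {B B' I J Y Y' : Set α} {b e : α}

/-! ### The facets -/

lemma IsIntDecomp.augFacet_eq (h : M.IsIntDecomp I B Y) : M.augFacet I =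
    (M.groundFinset (M.E \ M.extActive B)).image AugVertex.x ∪
      (M.groundFinset Y).image AugVertex.y ∪
      (M.groundFinset (I ∪ M.extActive B)).image AugVertex.z := by
  have hx : I ∪ M.extPassive I = M.E \ M.extActive B := by
    rw [← h.extActive_eq]
    ext e
    constructor
    · rintro (he | he)
      · exact ⟨h.isBase.subset_ground (h.subset he), fun h' => h'.1.2 he⟩
      · exact ⟨he.1.1, he.2⟩
    · rintro ⟨heE, he⟩
      by_cases heI : e ∈ I
      · exact Or.inl heI
      · exact Or.inr ⟨⟨heE, heI⟩, he⟩
  rw [augFacet, hx, h.intDeleted_eq, h.extActive_eq]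

lemma IsIntDecomp.x_mem_augFacet (h : M.IsIntDecomp I B Y) :
    AugVertex.x e ∈ M.augFacet I ↔ e ∈ M.E ∧ e ∉ M.extActive B := by
  simp only [h.augFacet_eq, Finset.mem_union, Finset.mem_image, mem_groundFinset, mem_sdiff,
    AugVertex.x.injEq, exists_eq_right, reduceCtorEq, and_false, exists_false, or_false]
  tauto

lemma IsIntDecomp.y_mem_augFacet (h : M.IsIntDecomp I B Y) :
    AugVertex.y e ∈ M.augFacet I ↔ e ∈ Y := by
  simp only [h.augFacet_eq, Finset.mem_union, Finset.mem_image, mem_groundFinset,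
    AugVertex.y.injEq, exists_eq_right, reduceCtorEq, and_false, exists_false, or_false, false_or]
  exact and_iff_right_of_imp fun he => h.isBase.subset_ground (h.deleted_subset he)

lemma IsIntDecomp.z_mem_augFacet (h : M.IsIntDecomp I B Y) :
    AugVertex.z e ∈ M.augFacet I ↔ e ∈ I ∪ M.extActive B := by
  simp only [h.augFacet_eq, Finset.mem_union, Finset.mem_image, mem_groundFinset,
    AugVertex.z.injEq, exists_eq_right, reduceCtorEq, and_false, exists_false, false_or]
  exact and_iff_right_of_imp fun he =>
    he.elim (fun he => h.isBase.subset_ground (h.subset he)) fun he => he.1.1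

lemma IsIntDecomp.card_augFacet (h : M.IsIntDecomp I B Y) :
    (M.augFacet I).card = M.E.ncard + B.ncard := by
  have hinj : Function.Injective (AugVertex.x : α → _) ∧
      Function.Injective (AugVertex.y : α → _) ∧ Function.Injective (AugVertex.z : α → _) :=
    ⟨fun _ _ h => AugVertex.x.inj h, fun _ _ h => AugVertex.y.inj h,
      fun _ _ h => AugVertex.z.inj h⟩
  have hE := M.ground_finite
  have hBE := h.isBase.subset_ground
  have hEA : M.extActive B ⊆ M.E := fun e he => he.1.1
  have hIE := h.subset.trans hBE
  have hYE := h.deleted_subset.trans hBE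
  rw [h.augFacet_eq, Finset.card_union_of_disjoint, Finset.card_union_of_disjoint,
    Finset.card_image_of_injective _ hinj.1, Finset.card_image_of_injective _ hinj.2.1,
    Finset.card_image_of_injective _ hinj.2.2, card_groundFinset sdiff_subset,
    card_groundFinset hYE, card_groundFinset (union_subset hIE hEA)]
  · have h1 := ncard_sdiff_add_ncard_of_subset hEA hE
    have h2 := ncard_sdiff_add_ncard_of_subset h.deleted_subset (hE.subset hBE)
    have h3 : (I ∪ M.extActive B).ncard = I.ncard + (M.extActive B).ncard :=
      ncard_union_eq (disjoint_left.2 fun e heI he => he.1.2 (h.subset heI))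
        (hE.subset hIE) (hE.subset hEA)
    rw [← h.2.2] at h2
    omega
  · rw [Finset.disjoint_left]
    simp only [Finset.mem_image]
    rintro _ ⟨a, -, rfl⟩ ⟨a', -, h⟩
    cases h
  · rw [Finset.disjoint_left]
    simp only [Finset.mem_union, Finset.mem_image]
    rintro _ (⟨a, -, rfl⟩ | ⟨a, -, rfl⟩) ⟨a', -, h⟩ <;> cases h

lemma Indep.card_augFacet_eq (hI : M.Indep I) (hJ : M.Indep J) :
    (M.augFacet I).card = (M.augFacet J).card := by
  obtain ⟨B, Y, h⟩ := hI.exists_isIntDecomp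
  obtain ⟨B', Y', h'⟩ := hJ.exists_isIntDecomp
  rw [h.card_augFacet, h'.card_augFacet, h.isBase.ncard_eq_ncard_of_isBase h'.isBase]

lemma augFacet_injOn (M : Matroid α) [M.Finite] : InjOn M.augFacet {I | M.Indep I} := by
  intro I hI J hJ hIJ
  obtain ⟨B, Y, h⟩ := Indep.exists_isIntDecomp hI
  obtain ⟨B', Y', h'⟩ := Indep.exists_isIntDecomp hJ
  -- the `x`-part determines the externally active elements, the `z`-part then determines `I`
  have hEA : ∀ e, e ∈ M.extActive B ↔ e ∈ M.extActive B' := by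
    intro e
    have hx := h.x_mem_augFacet (e := e)
    rw [hIJ, h'.x_mem_augFacet] at hx
    have h1 : e ∈ M.extActive B → e ∈ M.E := fun he => he.1.1
    have h2 : e ∈ M.extActive B' → e ∈ M.E := fun he => he.1.1
    tauto
  ext e
  have hz := h.z_mem_augFacet (e := e)
  rw [hIJ, h'.z_mem_augFacet, mem_union, mem_union, hEA e] at hz
  have h1 : e ∈ I → e ∉ M.extActive B' := fun heI he =>
    ((hEA e).2 he).1.2 (h.subset heI)
  have h2 : e ∈ J → e ∉ M.extActive B' := fun heJ he => he.1.2 (h'.subset heJ)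
  tauto

lemma augFacet_bijOn_facets (M : Matroid α) [M.Finite] :
    BijOn M.augFacet {I | M.Indep I} M.augExtActivityComplex.facets := by
  refine ⟨fun I hI => ⟨⟨I, hI, Finset.Subset.rfl⟩, fun G ⟨J, hJ, hGJ⟩ hIG => ?_⟩,
    M.augFacet_injOn, fun F hF => ?_⟩
  · have heq : M.augFacet I = M.augFacet J :=
      Finset.eq_of_subset_of_card_le (hIG.trans hGJ) (Indep.card_augFacet_eq hJ hI).le
    rw [heq]
    exact hGJ
  · obtain ⟨I, hI, hFI⟩ := hF.prop
    exact ⟨I, hI, (hF.le_of_ge ⟨I, hI, Finset.Subset.rfl⟩ hFI).antisymm hFI⟩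

/-! ### The shelling -/

lemma inter_eq_erase_of_erase_subset {V : Type*} [DecidableEq V] {F G : Finset V} {v : V}
    (hcard : G.card = F.card) (hne : G ≠ F) (h : F.erase v ⊆ G) : G ∩ F = F.erase v := by
  refine Finset.Subset.antisymm (fun w hw => ?_)
    (Finset.subset_inter h (Finset.erase_subset v F))
  refine Finset.mem_erase.2 ⟨?_, Finset.mem_of_mem_inter_right hw⟩
  rintro rfl
  have hsub : F ⊆ G := fun u hu => by
    by_cases huw : u = w
    · exact huw ▸ Finset.mem_of_mem_inter_left hw
    · exact h (Finset.mem_erase.2 ⟨huw, hu⟩)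
  exact hne (Finset.eq_of_subset_of_card_le hsub hcard.le).symm

lemma IsIntDecomp.erase_z_subset_augFacet (h : M.IsIntDecomp I B Y) (h' : M.IsIntDecomp J B' Y')
    (hx : M.extActive B' ⊆ M.extActive B) (hy : Y ⊆ Y')
    (hz : ∀ e ∈ I ∪ M.extActive B, e ≠ b → e ∈ J ∪ M.extActive B') :
    (M.augFacet I).erase (AugVertex.z b) ⊆ M.augFacet J := by
  intro v hv
  obtain ⟨hvb, hv⟩ := Finset.mem_erase.1 hv
  cases v with
  | x e =>
    rw [h.x_mem_augFacet] at hv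
    exact h'.x_mem_augFacet.2 ⟨hv.1, fun he => hv.2 (hx he)⟩
  | y e => exact h'.y_mem_augFacet.2 (hy (h.y_mem_augFacet.1 hv))
  | z e =>
    exact h'.z_mem_augFacet.2 (hz e (h.z_mem_augFacet.1 hv) fun he => hvb (he ▸ rfl))

/-- The restriction set of `F(I)` contains `z_b` for all `b ∈ I`. If `b` is internally active in
`B`, the neighbouring facet is that of `I \ b`; otherwise it is obtained by a pivot. -/
lemma IsIntDecomp.exists_neighbour (h : M.IsIntDecomp I B Y) (hb : b ∈ I) :
    ∃ J, M.Indep J ∧ J ≠ I ∧ M.ExtIntLE J I ∧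
      (M.augFacet I).erase (AugVertex.z b) ⊆ M.augFacet J := by
  have hB := h.isBase
  have hbB := h.subset hb
  have hI_iff : ∀ e, e ∈ I ↔ e ∈ B ∧ e ∉ Y := fun e => by rw [h.2.2]; rfl
  by_cases hbI : b ∈ M.intActive B
  · have h' : M.IsIntDecomp (I \ {b}) B (insert b Y) := by
      refine ⟨hB, insert_subset hbI h.2.1, ?_⟩
      rw [h.2.2, sdiff_sdiff, union_singleton]
    refine ⟨I \ {b}, h'.indep, fun heq => ?_, (h'.extIntLE_iff h).2 (Or.inr ⟨rfl, sdiff_subset⟩),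
      h.erase_z_subset_augFacet h' Subset.rfl (subset_insert _ _) fun e he heb => ?_⟩
    · rw [← heq] at hb
      exact hb.2 rfl
    · exact he.imp_left fun he => ⟨he, heb⟩
  · -- the two pivots share everything but the set deleted from the new basis
    suffices hpiv : ∃ c Y', c ∈ M.E \ B ∧ M.Exchangeable B b c ∧
        M.extActive (insert c (B \ {b})) ⊆ M.extActive B ∧
        M.extActive B \ {c} ⊆ M.extActive (insert c (B \ {b})) ∧
        M.intActive B ⊆ M.intActive (insert c (B \ {b})) ∧
        c ∈ M.extActive B ∪ M.intActive (insert c (B \ {b})) ∧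
        Y ⊆ Y' ∧ Y' ⊆ insert c Y ∧ Y' ⊆ M.intActive (insert c (B \ {b})) ∧
        (c ∈ M.extActive B → c ∉ Y') by
      obtain ⟨c, Y', hc, hbc, hEA, hEA', hIA, hcmem, hYY', hY'Y, hY', hcY'⟩ := hpiv
      have h' : M.IsIntDecomp (insert c (B \ {b}) \ Y') (insert c (B \ {b})) Y' :=
        ⟨hB.pivot hbB hc hbc, hY', rfl⟩
      have hbpiv : b ∉ insert c (B \ {b}) := fun hmem =>
        hmem.elim (fun hbc' => hc.2 (hbc' ▸ hbB)) fun hmem => hmem.2 rfl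
      refine ⟨_, h'.indep, fun heq => hbpiv (h'.subset (heq.symm ▸ hb)), ?_,
        h.erase_z_subset_augFacet h' hEA hYY' fun e he heb => ?_⟩
      · refine (h'.extIntLE_iff h).2 (Or.inl ⟨fun heq => ?_, extIntSet_pivot_subset hEA hIA hcmem⟩)
        exact hbpiv (by rw [heq]; exact hbB)
      · rcases he with he | he
        · obtain ⟨heB, heY⟩ := (hI_iff e).1 he
          refine Or.inl ⟨Or.inr ⟨heB, heb⟩, fun heY' => ?_⟩
          exact (hY'Y heY').elim (fun hec => hc.2 (hec ▸ heB)) heY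
        · by_cases hec : e = c
          · subst hec
            exact Or.inl ⟨mem_insert _ _, hcY' he⟩
          · exact Or.inr (hEA' ⟨he, hec⟩)
    by_cases hex : ∃ f ∈ M.extActive B, M.Exchangeable B b f
    · have hfin : {f | f ∈ M.extActive B ∧ M.Exchangeable B b f}.Finite :=
        M.ground_finite.subset fun f hf => hf.1.1.1
      obtain ⟨c, ⟨hc, hbc⟩, hmin⟩ := exists_min_image _ id hfin hex
      obtain ⟨hEA, hIA⟩ := hB.pivot_extActive hbB hc hbc fun f hf hbf => hmin f ⟨hf, hbf⟩
      exact ⟨c, Y, hc.1, hbc, hEA.subset.trans sdiff_subset, hEA.symm.subset, hIA, Or.inl hc,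
        Subset.rfl, subset_insert _ _, h.2.1.trans hIA,
        fun _ hcY => hc.1.2 (h.deleted_subset hcY)⟩
    · push Not at hex
      obtain ⟨f₀, hf₀, hbf₀, hlt₀⟩ : ∃ c ∈ M.E \ B, M.Exchangeable B b c ∧ ¬ c < b := by
        by_contra! hcon
        exact hbI (hB.mem_intActive_iff.2 ⟨hbB, hcon⟩)
      have hfin : {f | f ∈ M.E \ B ∧ M.Exchangeable B b f}.Finite :=
        M.ground_finite.subset fun f hf => hf.1.1
      obtain ⟨c, ⟨hc, hbc⟩, hmax⟩ := exists_max_image _ id hfin ⟨f₀, hf₀, hbf₀⟩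
      have hlt : b < c := by
        refine lt_of_le_of_ne ((not_lt.1 hlt₀).trans (hmax f₀ ⟨hf₀, hbf₀⟩)) ?_
        rintro rfl
        exact hc.2 hbB
      obtain ⟨hEA, hIA⟩ := hB.pivot_max hbB hc hbc hlt (fun f hf hbf => hmax f ⟨hf, hbf⟩) hex
      exact ⟨c, insert c Y, hc, hbc, hEA.subset, sdiff_subset.trans hEA.symm.subset,
        (subset_insert _ _).trans hIA, Or.inr (hIA (mem_insert _ _)), subset_insert _ _,
        Subset.rfl, (insert_subset_insert h.2.1).trans hIA, fun hcE => (hex c hcE hbc).elim⟩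

/-- The shelling condition: unless `I ≤ I'`, some `z_b` with `b ∈ I` is missing from `F(I')`, and
then the neighbour of `F(I)` across `z_b` does the job. -/
lemma Indep.exists_shelling_neighbour (hI : M.Indep I) (hJ : M.Indep J)
    (hle : ¬ M.ExtIntLE I J) :
    ∃ K, M.Indep K ∧ K ≠ I ∧ M.ExtIntLE K I ∧ ∃ v ∈ M.augFacet I,
      M.augFacet J ∩ M.augFacet I ⊆ M.augFacet K ∩ M.augFacet I ∧
      M.augFacet K ∩ M.augFacet I = (M.augFacet I).erase v := by
  obtain ⟨B, Y, h⟩ := hI.exists_isIntDecomp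
  obtain ⟨B', Y', h'⟩ := hJ.exists_isIntDecomp
  obtain ⟨b, hb, hbJ⟩ := not_subset.1 fun hsub => hle (h.extIntLE_of_subset_union h' hsub)
  obtain ⟨K, hK, hne, hKI, hsub⟩ := h.exists_neighbour hb
  have heq := inter_eq_erase_of_erase_subset (Indep.card_augFacet_eq hK hI)
    (fun heq => hne (M.augFacet_injOn hK hI heq)) hsub
  refine ⟨K, hK, hne, hKI, AugVertex.z b, h.z_mem_augFacet.2 (Or.inl hb), ?_, heq⟩
  rw [heq]
  intro v hv
  refine Finset.mem_erase.2 ⟨?_, Finset.mem_of_mem_inter_right hv⟩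
  rintro rfl
  exact hbJ (h'.z_mem_augFacet.1 (Finset.mem_of_mem_inter_left hv))

lemma IsExtIntLinearExtension.isShellingOrder {s : ℕ} {I : Fin s → Set α}
    (h : M.IsExtIntLinearExtension I) :
    M.augExtActivityComplex.IsShellingOrder fun k => M.augFacet (I k) := by
  obtain ⟨hinj, hrange, hext⟩ := h
  have hind : ∀ k, M.Indep (I k) := fun k => hrange.subset (mem_range_self k)
  have hbij := M.augFacet_bijOn_facets
  refine ⟨fun F hF G hG => ?_, fun k l hkl => hinj (hbij.injOn (hind k) (hind l) hkl), ?_,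
    fun i k hik => ?_⟩
  · obtain ⟨J, hJ, rfl⟩ := hbij.surjOn hF
    obtain ⟨K, hK, rfl⟩ := hbij.surjOn hG
    exact Indep.card_augFacet_eq hJ hK
  · rw [← hbij.image_eq, ← hrange, ← range_comp]
    rfl
  · obtain ⟨K, hK, hne, hKI, hv⟩ := (hind k).exists_shelling_neighbour (hind i)
      fun hle => hik.not_ge (hext k i hle)
    obtain ⟨j, rfl⟩ := hrange.symm.subset hK
    exact ⟨j, lt_of_le_of_ne (hext j k hKI) fun hjk => hne (hjk ▸ rfl), hv⟩

lemma exists_equiv_fin_of_isPartialOrder {β : Type*} [Finite β] (r : β → β → Prop)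
    (hrefl : ∀ a, r a a) (htrans : ∀ a b c, r a b → r b c → r a c)
    (hanti : ∀ a b, r a b → r b a → a = b) :
    ∃ (s : ℕ) (φ : Fin s ≃ β), ∀ k l, r (φ k) (φ l) → k ≤ l := by
  let _ : PartialOrder β :=
    { le := r, le_refl := hrefl, le_trans := htrans, le_antisymm := hanti }
  have : Fintype (LinearExtension β) := @Fintype.ofFinite _ (inferInstanceAs (Finite β))
  let φ := monoEquivOfFin (LinearExtension β) rfl
  let ψ : Fin _ ≃ β := φ.toEquiv
  refine ⟨_, ψ, fun k l hkl => φ.le_iff_le.1 ?_⟩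
  exact (toLinearExtension (α := β)).monotone' (a := ψ k) (b := ψ l) hkl

lemma exists_isExtIntLinearExtension (M : Matroid α) [M.Finite] :
    ∃ (s : ℕ) (I : Fin s → Set α), M.IsExtIntLinearExtension I := by
  have : Finite {I // M.Indep I} :=
    M.ground_finite.finite_subsets.subset fun I hI => Indep.subset_ground hI
  obtain ⟨s, φ, hφ⟩ := exists_equiv_fin_of_isPartialOrder
    (fun I J : {I // M.Indep I} => M.ExtIntLE I J) (fun I => I.2.extIntLE_refl)
    (fun I J K => I.2.extIntLE_trans J.2 K.2)
    (fun I J h h' => Subtype.ext (I.2.extIntLE_antisymm J.2 h h'))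
  refine ⟨s, fun k => φ k, fun k l hkl => φ.injective (Subtype.ext hkl), ?_, hφ⟩
  ext I
  constructor
  · rintro ⟨k, rfl⟩
    exact (φ k).2
  · intro hI
    obtain ⟨k, hk⟩ := φ.surjective ⟨I, hI⟩
    exact ⟨k, congrArg Subtype.val hk⟩

end Complex

end Matroid

theorem mainTheorem1 {α : Type*} [LinearOrder α] (M : Matroid α) [M.Finite] :
    -- every independent set is uniquely `B \ Y` with `B` a basis and `Y ⊆ IA(B)`
    (∀ I, M.Indep I → ∃! p : Set α × Set α, M.IsIntDecomp I p.1 p.2) ∧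
    -- `I ↦ F(I)` is a bijection from the independent sets to the facets
    Set.BijOn M.augFacet {I | M.Indep I} M.augExtActivityComplex.facets ∧
    -- the external/internal order is a partial order on the independent sets
    ((∀ I, M.Indep I → M.ExtIntLE I I) ∧
      (∀ I J, M.Indep I → M.Indep J → M.ExtIntLE I J → M.ExtIntLE J I → I = J) ∧
      (∀ I J K, M.Indep I → M.Indep J → M.Indep K →
        M.ExtIntLE I J → M.ExtIntLE J K → M.ExtIntLE I K)) ∧
    -- every linear extension of it induces a shelling order
    (∀ (s : ℕ) (I : Fin s → Set α), M.IsExtIntLinearExtension I →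
      M.augExtActivityComplex.IsShellingOrder (fun k => M.augFacet (I k))) ∧
    M.augExtActivityComplex.IsShellable ∧
    (∀ (R : Type*) [CommRing R], M.augExtActivityComplex.IsCohenMacaulay R) := by

  obtain ⟨s, I, hext⟩ := M.exists_isExtIntLinearExtension
  have hshell := hext.isShellingOrder
  refine ⟨fun I hI => ?_, M.augFacet_bijOn_facets,
    ⟨fun I hI => hI.extIntLE_refl, fun I J hI hJ => hI.extIntLE_antisymm hJ,
      fun I J K hI hJ hK => hI.extIntLE_trans hJ hK⟩,
    fun s I hI => hI.isShellingOrder, ⟨s, _, hshell⟩, fun R _ => ?_⟩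
  · obtain ⟨B, Y, h⟩ := hI.exists_isIntDecomp
    exact ⟨(B, Y), h, fun p hp => Prod.ext (hp.base_unique h) (hp.deleted_unique h)⟩
  · refine hshell.isCohenMacaulay (fun G hG => ?_) R
    obtain ⟨J, hJ, hGJ⟩ := hG
    obtain ⟨k, rfl⟩ := hext.2.1.symm.subset hJ
    exact ⟨k, hGJ⟩
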